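/- Let $d\ge 1$, $L>0$, and let $$\mathcal P_0=\Big\{p:\mathbb R^d\to\mathbb R \;\Big|\; p\ge 0,\ \int_{\mathbb R^d}p(x)\,dx=1,\ \|p\|_\infty\le L\Big\},$$ where $\|\cdot\|_\infty$ is the $L_\infty(\mathbb R^d)$ norm; write $\|\cdot\|$ for the norm of $L_2(\mathbb R^d)$. An estimator $T_n=T_n(\cdot\,;X_1,\dots,X_n)$ is a real function that is jointly measurable in the sample and in $x\in\mathbb R^d$; its risk is $R_n(T_n,p)=E_p^n\|T_n-p\|^2\in[0,\infty]$, where $E_p^n$ is the expectation when $X_1,\dots,X_n$ are i.i.d. with density $p$. For $p_1,\dots,p_M\in L_2(\mathbb R^d)$ and $\lambda\in\mathbb R^M$ put $\mathsf p_\lambda=\sum_{j=1}^M\lambda_jp_j$, and let $$\Lambda^M=\Big\{\lambda\in\mathbb R^M:\ \lambda_j\ge 0,\ \sum_{j=1}^M\lambda_j\le 1\Big\}.$$ A convex aggregate of $p_1,\dots,p_M$ is $\tilde p_n^{\mathbf C}=\mathsf p_{\hat\lambda}$, where $\hat\lambda$ is a measurable function of the sample and $$\hat\lambda\in\operatorname*{argmin}_{\lambda\in\Lambda^M}\Big\{\|\mathsf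 p_\lambda\|^2-\frac2n\sum_{i=1}^n\mathsf p_\lambda(X_i)\Big\}.$$ Corollary 3.2. There is an absolute constant $C<\infty$ and, for every $c_0>0$, a constant $c>0$ depending only on $c_0$, such that for all $d\ge1$ and $L>0$ the following holds; that is, in the range of integers $M\ge 2$, $n\ge 1$ with $M\le c_0n$, $\psi_n(M)=LM/n$ is the optimal rate of convex aggregation (the optimal rate of aggregation for $H=\Lambda^M$ over $\mathcal P_0$), and the convex aggregate is rate optimal. 1. (Upper bound.) For all integers $M\ge2$, $n\ge1$ with $M\le c_0n$ and all $p_1,\dots,p_M\in L_2(\mathbb R^d)$, there exists a convex aggregate, and every convex aggregate $\tilde p_n^{\mathbf C}$ is an estimator satisfying $$\sup_{p\in\mathcal P_0}\Big[R_n(\tilde p_n^{\mathbf C},p)-\inf_{\lambda\in\Lambda^M}\|\mathsf p_\lambda-p\|^2\Big]\le C\,\frac{LM}{n}.$$ 2. (Lower bound.) For every integer $M\ge2$ there exist $p_1,\dots,p_M\in L_2(\mathbb R^d)$ such that, for every integer $n\ge1$ with $M\le c_0n$ and every estimator $T_n$, $$\sup_{p\in\mathcal P_0}\Big[R_n(T_n,p)-\inf_{\lambda\in\Lambda^M}\|\mathsf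 p_\lambda-p\|^2\Big]\ge c\,\frac{LM}{n}.$$ -/

import Mathlib

open MeasureTheory
open scoped ENNReal

namespace DensityAggregation

noncomputable section

/-- The points of `ℝ^d`. Only Lebesgue measure is used on it, never a norm. -/
abbrev Pt (d : ℕ) : Type := Fin d → ℝ

/-- The squared `L₂(ℝ^d)` distance `‖f - g‖²` with respect to Lebesgue measure. -/
def sqDist {d : ℕ} (f g : Pt d → ℝ) : ℝ≥0∞ :=
  ∫⁻ x, ENNReal.ofReal ((f x - g x) ^ 2)

/-- The combination `p_w = ∑ j, w j * p j`. -/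
def mix {d M : ℕ} (p : Fin M → Pt d → ℝ) (w : Fin M → ℝ) : Pt d → ℝ :=
  fun x => ∑ j, w j * p j x

/-- The class of all probability densities on `ℝ^d` bounded by `L` in the `L_∞` norm.
(`∫ x, p x = 1` forces integrability, because a non-integrable function has integral `0`.) -/
def boundedDensities (d : ℕ) (L : ℝ) : Set (Pt d → ℝ) :=
  {p | (∀ x, 0 ≤ p x) ∧ ∫ x, p x = 1 ∧ eLpNorm p ∞ volume ≤ ENNReal.ofReal L}

/-- The law of `n` i.i.d. observations with common density `p`. -/
def sampleLaw {d : ℕ} (n : ℕ) (p : Pt d → ℝ) : Measure (Fin n → Pt d) :=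
  Measure.pi fun _ => volume.withDensity fun x => ENNReal.ofReal (p x)

/-- An estimator based on `n` observations: a function of the sample and of the point `x`
that is jointly (Lebesgue) measurable. -/
def IsEstimator {d n : ℕ} (T : (Fin n → Pt d) → Pt d → ℝ) : Prop :=
  AEMeasurable (Function.uncurry T) (volume : Measure ((Fin n → Pt d) × Pt d))

/-- The risk `R_n(T, p)`: the expectation of `‖T - p‖²` (possibly infinite). -/
def risk {d n : ℕ} (T : (Fin n → Pt d) → Pt d → ℝ) (p : Pt d → ℝ) : ℝ≥0∞ :=
  ∫⁻ X, sqDist (T X) p ∂(sampleLaw n p)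

/-- The excess risk `R_n(T, p) - inf_{w ∈ H} ‖p_w - p‖²`, as an extended real number. -/
def excessRisk {d M n : ℕ} (H : Set (Fin M → ℝ)) (f : Fin M → Pt d → ℝ)
    (T : (Fin n → Pt d) → Pt d → ℝ) (p : Pt d → ℝ) : EReal :=
  (risk T p : EReal) - ((⨅ w ∈ H, sqDist (mix f w) p : ℝ≥0∞) : EReal)

/-- The maximal excess risk over a class `P` of densities. -/
def maxExcessRisk {d M n : ℕ} (P : Set (Pt d → ℝ)) (H : Set (Fin M → ℝ))
    (f : Fin M → Pt d → ℝ) (T : (Fin n → Pt d) → Pt d → ℝ) : EReal :=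
  ⨆ p ∈ P, excessRisk H f T p

/-- An aggregation procedure: for all `M`, `n` and functions `f 1, …, f M`, it returns a function
of the sample `X` and of the point `x`. -/
abbrev Procedure (d : ℕ) : Type :=
  ∀ M n : ℕ, (Fin M → Pt d → ℝ) → (Fin n → Pt d) → Pt d → ℝ

/-- The lower bound in the definition of an optimal rate: for each `M` there are functions in
`L₂` such that, for every `n` with `(M, n)` in the range `D`, no estimator has a maximal excess
risk below `c * ψ M n`. -/
def LowerBound {d : ℕ} (P : Set (Pt d → ℝ)) (H : ∀ M : ℕ, Set (Fin M → ℝ)) (D : Set (ℕ × ℕ))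
    (ψ : ℕ → ℕ → ℝ) (c : ℝ) : Prop :=
  ∀ M : ℕ, ∃ f : Fin M → Pt d → ℝ, (∀ j, MemLp (f j) 2 volume) ∧
    ∀ n : ℕ, (M, n) ∈ D → ∀ T : (Fin n → Pt d) → Pt d → ℝ, IsEstimator T →
      ((c * ψ M n : ℝ) : EReal) ≤ maxExcessRisk P (H M) f T

/-- `ψ` is an optimal rate of aggregation for the weights `H` over the class `P`, in the range `D`
of pairs `(M, n)`, with the constant `C` in the upper bound and `c` in the lower bound. -/
def IsOptimalRate {d : ℕ} (P : Set (Pt d → ℝ)) (H : ∀ M : ℕ, Set (Fin M → ℝ)) (D : Set (ℕ × ℕ))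
    (ψ : ℕ → ℕ → ℝ) (C c : ℝ) : Prop :=
  (∀ M n : ℕ, (M, n) ∈ D → 0 < ψ M n) ∧
  (∀ M n : ℕ, (M, n) ∈ D → ∀ f : Fin M → Pt d → ℝ, (∀ j, MemLp (f j) 2 volume) →
    ∃ T : (Fin n → Pt d) → Pt d → ℝ, IsEstimator T ∧
      maxExcessRisk P (H M) f T ≤ ((C * ψ M n : ℝ) : EReal)) ∧
  0 < c ∧ LowerBound P H D ψ c

/-- The procedure `A` is a rate optimal aggregate (with constants `C` and `c`): the lower bound
holds, and `A` attains the upper bound for all initial functions in `L₂`. -/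
def IsRateOptimalAggregate {d : ℕ} (P : Set (Pt d → ℝ)) (H : ∀ M : ℕ, Set (Fin M → ℝ))
    (D : Set (ℕ × ℕ)) (ψ : ℕ → ℕ → ℝ) (C c : ℝ) (A : Procedure d) : Prop :=
  (0 < c ∧ LowerBound P H D ψ c) ∧
  ∀ M n : ℕ, (M, n) ∈ D → ∀ f : Fin M → Pt d → ℝ, (∀ j, MemLp (f j) 2 volume) →
    IsEstimator (A M n f) ∧ maxExcessRisk P (H M) f (A M n f) ≤ ((C * ψ M n : ℝ) : EReal)

/-- The simplex `Λ^M`: nonnegative weights with sum at most one. -/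
def simplex (M : ℕ) : Set (Fin M → ℝ) :=
  {w | (∀ j, 0 ≤ w j) ∧ ∑ j, w j ≤ 1}

/-- The empirical criterion `‖p_w‖² - (2 / n) ∑ i, p_w (X i)`. -/
def criterion {d M n : ℕ} (f : Fin M → Pt d → ℝ) (X : Fin n → Pt d) (w : Fin M → ℝ) : ℝ :=
  (∫ x, mix f w x ^ 2) - 2 / (n : ℝ) * ∑ i, mix f w (X i)

/-- `T` is a convex aggregate of `f 1, …, f M`: it is `p_w` at a weight vector `w = w(X)` which is
a (Lebesgue) measurable function of the sample and minimizes the empirical criterion over `H`. -/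
def IsConvexAggregate {d M n : ℕ} (H : Set (Fin M → ℝ)) (f : Fin M → Pt d → ℝ)
    (T : (Fin n → Pt d) → Pt d → ℝ) : Prop :=
  ∃ w : (Fin n → Pt d) → Fin M → ℝ, AEMeasurable w volume ∧
    ∀ X, w X ∈ H ∧ IsMinOn (criterion f X) H (w X) ∧ T X = mix f (w X)

/-- The procedure `A` is the convex aggregate over the simplex (for all `M ≥ 2`, `n ≥ 1` and all
initial functions in `L₂`). A minimizer of the criterion need not be unique, so this is a property
of `A`. -/
def IsConvexProcedure {d : ℕ} (A : Procedure d) : Prop :=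
  ∀ M n : ℕ, 2 ≤ M → 1 ≤ n → ∀ f : Fin M → Pt d → ℝ, (∀ j, MemLp (f j) 2 volume) →
    IsConvexAggregate (simplex M) f (A M n f)

/-- The range of the result: `M ≥ 2`, `n ≥ 1` and `M ≤ c₀ n`. -/
def range (c₀ : ℝ) : Set (ℕ × ℕ) :=
  {q | 2 ≤ q.1 ∧ 1 ≤ q.2 ∧ (q.1 : ℝ) ≤ c₀ * (q.2 : ℝ)}

end

end DensityAggregation

/-! Upper bound. In an orthonormal basis of the span of the `f j` (of dimension `r ≤ M`), both the
loss `‖p_w - p‖²` and the criterion are, up to a constant, `|c|² - 2⟨c, y⟩`. Here `y` holds the true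
coefficients of `p` for the loss and their empirical means for the criterion; let `η` be the error
of these means. A minimizer over a convex set beats any competitor by at least the squared distance
between them (`quadratic_gap_of_isMinOn`). This gap absorbs the cross term, so the loss of the
aggregate exceeds that of any `w` by at most `|η|²`. Each `η k` has mean square at most `L / n`
because `p ≤ L`; hence `C = 1` (`risk_convexAggregate_le`). A measurable minimizer is a pointwise
limit of ridge minimizers (`exists_measurable_minimizer`).

Lower bound. Take `m = M - 1` pairs of cells with a flat density of height `L / 2`, and tilt any
subset of the pairs by a relative amount `γ` with `γ²` of order `M / n`. All `2 ^ m` densities are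
convex combinations of one dictionary of `M` functions, so the oracle term vanishes. Flipping one
pair costs order `L² γ² v` in loss, `v` being the volume of a cell, yet cannot be detected from `n`
observations (`two_point_bound`). Averaging over the cube (`exists_risk_ge`) gives a risk of order
`L γ²`, that is `L M / n`. -/

namespace DensityAggregation

/-! ### Product densities and the two point bound. -/

theorem lintegral_fin_prod_eq_prod {Ω : Type*} [MeasurableSpace Ω] {n : ℕ}
    (μ : Fin n → Measure Ω) [∀ i, SigmaFinite (μ i)] {f : Fin n → Ω → ℝ≥0∞}
    (hf : ∀ i, Measurable (f i)) :
    ∫⁻ x : Fin n → Ω, ∏ i, f i (x i) ∂(Measure.pi μ) = ∏ i, ∫⁻ x, f i x ∂(μ i) := by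
  induction n with
  | zero => simp
  | succ n ih =>
    have hg : Measurable fun x : Fin n → Ω => ∏ i : Fin n, f i.succ (x i) :=
      Finset.measurable_prod _ fun i _ => (hf i.succ).comp (measurable_pi_apply i)
    calc
      _ = ∫⁻ x : Ω × (Fin n → Ω), f 0 x.1 * ∏ i : Fin n, f i.succ (x.2 i)
            ∂((μ 0).prod (Measure.pi fun i => μ i.succ)) := by
        rw [← ((measurePreserving_piFinSuccAbove μ 0).symm).lintegral_comp_emb
          (MeasurableEquiv.measurableEmbedding _)]
        simp_rw [MeasurableEquiv.piFinSuccAbove_symm_apply, Fin.insertNthEquiv,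
          Fin.prod_univ_succ, Fin.insertNth_zero, Equiv.coe_fn_mk, Fin.cons_succ,
          Fin.zero_succAbove, cast_eq, Fin.cons_zero]
      _ = (∫⁻ x, f 0 x ∂μ 0) * ∏ i : Fin n, ∫⁻ x, f i.succ x ∂(μ i.succ) := by
        rw [← ih _ fun i => hf i.succ, ← lintegral_prod_mul (hf 0).aemeasurable hg.aemeasurable]
      _ = _ := by rw [Fin.prod_univ_succ]

theorem pi_withDensity {Ω : Type*} [MeasurableSpace Ω] {n : ℕ} (μ : Measure Ω) [SigmaFinite μ]
    {ρ : Ω → ℝ≥0∞} (hρ : Measurable ρ) [SigmaFinite (μ.withDensity ρ)] :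
    Measure.pi (fun _ : Fin n => μ.withDensity ρ)
      = (Measure.pi fun _ : Fin n => μ).withDensity fun x => ∏ i, ρ (x i) := by
  refine Measure.pi_eq fun s hs => ?_
  rw [withDensity_apply _ (MeasurableSet.univ_pi hs), Measure.restrict_pi_pi,
    lintegral_fin_prod_eq_prod _ fun _ => hρ]
  exact Finset.prod_congr rfl fun i _ => (withDensity_apply _ (hs i)).symm

/-- For `l ≥ 1` this is `(l / 2 - 1)² ≥ 0`. It bounds the affinity `∫ min 1 l` of two laws from
below by the second moment of their likelihood ratio, which factorizes over the sample. -/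
theorem le_min_one_add_sq_div_four {l : ℝ≥0∞} (hl : l ≠ ∞) : l ≤ min 1 l + l ^ 2 / 4 := by
  rcases le_total l 1 with h | h
  · rw [min_eq_right h]; exact le_self_add
  · rw [min_eq_left h]
    lift l to NNReal using hl
    have : l ≤ 1 + l ^ 2 / 4 := by
      rw [← NNReal.coe_le_coe]; push_cast; nlinarith [sq_nonneg ((l : ℝ) / 2 - 1)]
    have h4 : ((l ^ 2 / 4 : NNReal) : ℝ≥0∞) = (l : ℝ≥0∞) ^ 2 / 4 := by
      rw [ENNReal.coe_div (by norm_num)]; push_cast; rfl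
    rw [← h4]
    exact_mod_cast this

/-- Le Cam's two point bound for samples from `μ` and from `ρ μ`. -/
theorem two_point_bound {Ω : Type*} [MeasurableSpace Ω] (μ : Measure Ω) [IsProbabilityMeasure μ]
    {ρ : Ω → ℝ≥0∞} (hρ : Measurable ρ) (hfin : ∀ x, ρ x ≠ ∞) (hone : ∫⁻ x, ρ x ∂μ = 1) {n : ℕ}
    (hsq : (∫⁻ x, ρ x ^ 2 ∂μ) ^ n ≤ 2) {a b : (Fin n → Ω) → ℝ≥0∞}
    (ha : AEMeasurable a (Measure.pi fun _ => μ)) {δ : ℝ≥0∞} (hδ : δ ≠ ∞)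
    (hab : ∀ᵐ X ∂(Measure.pi fun _ : Fin n => μ), δ ≤ a X + b X) :
    δ / 2 ≤ ∫⁻ X, a X ∂(Measure.pi fun _ => μ)
      + ∫⁻ X, b X ∂(Measure.pi fun _ => μ.withDensity ρ) := by
  have : IsProbabilityMeasure (μ.withDensity ρ) := ⟨by simpa using hone⟩
  set P := Measure.pi fun _ : Fin n => μ
  set l : (Fin n → Ω) → ℝ≥0∞ := fun X => ∏ i, ρ (X i) with hl
  have hlm : Measurable l :=
    Finset.measurable_prod _ fun i _ => hρ.comp (measurable_pi_apply i)
  have hlfin : ∀ X, l X ≠ ∞ := fun X => ENNReal.prod_ne_top fun i _ => hfin _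
  have hl1 : ∫⁻ X, l X ∂P = 1 := by
    rw [hl, lintegral_fin_prod_eq_prod _ fun _ => hρ]; simp [hone]
  have hl2 : ∫⁻ X, l X ^ 2 ∂P ≤ 2 := by
    refine le_of_eq_of_le ?_ hsq
    simp_rw [hl, ← Finset.prod_pow]
    rw [lintegral_fin_prod_eq_prod (fun _ => μ) (f := fun _ x => ρ x ^ 2) fun _ => hρ.pow_const 2]
    simp
  -- `b` carries no measurability hypothesis; finiteness of the density `l` replaces it.
  rw [pi_withDensity μ hρ, lintegral_withDensity_eq_lintegral_mul_non_measurable _ hlm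
    (.of_forall fun X => (hlfin X).lt_top)]
  have key : ∀ᵐ X ∂P, δ * l X ≤ (a X + l X * b X) + δ / 4 * l X ^ 2 := by
    filter_upwards [hab] with X hX
    calc δ * l X ≤ δ * (min 1 (l X) + l X ^ 2 / 4) := by
          gcongr; exact le_min_one_add_sq_div_four (hlfin X)
      _ = δ * min 1 (l X) + δ / 4 * l X ^ 2 := by
          rw [mul_add, div_eq_mul_inv, div_eq_mul_inv]; ring
      _ ≤ (a X + b X) * min 1 (l X) + δ / 4 * l X ^ 2 := by gcongr
      _ ≤ _ := by
          gcongr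
          rw [add_mul, mul_comm (b X)]
          gcongr
          · exact (mul_le_of_le_one_right (zero_le) (min_le_left _ _))
          · exact min_le_right _ _
  -- Integrate `key`: `l` has mean one and second moment at most two, so the quadratic term loses
  -- only half of `δ`.
  have h1 : δ ≤ (∫⁻ X, a X ∂P + ∫⁻ X, l X * b X ∂P) + δ / 2 := by
    calc δ = ∫⁻ X, δ * l X ∂P := by rw [lintegral_const_mul _ hlm, hl1, mul_one]
      _ ≤ ∫⁻ X, (a X + l X * b X) + δ / 4 * l X ^ 2 ∂P := lintegral_mono_ae key
      _ = (∫⁻ X, a X ∂P + ∫⁻ X, l X * b X ∂P) + δ / 4 * ∫⁻ X, l X ^ 2 ∂P := by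
          rw [lintegral_add_right _ ((hlm.pow_const 2).const_mul _), lintegral_add_left' ha,
            lintegral_const_mul _ (hlm.pow_const 2)]
      _ ≤ (∫⁻ X, a X ∂P + ∫⁻ X, l X * b X ∂P) + δ / 4 * 2 := by gcongr
      _ = _ := by
          congr 1
          rw [div_eq_mul_inv, div_eq_mul_inv, mul_assoc]
          congr 1
          rw [show (4 : ℝ≥0∞) = 2 * 2 by norm_num, ENNReal.mul_inv (by norm_num) (by norm_num),
            mul_assoc, ENNReal.inv_mul_cancel (by norm_num) (by norm_num), mul_one]
  have h2 : δ / 2 + δ / 2 ≤ (∫⁻ X, a X ∂P + ∫⁻ X, l X * b X ∂P) + δ / 2 := by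
    rwa [ENNReal.add_halves]
  exact (ENNReal.add_le_add_iff_right (ENNReal.div_ne_top hδ (by norm_num))).1 h2

/-! ### Orthonormal coordinates, empirical means, and the gap of a convex quadratic. -/

/-- Finitely many vectors are combinations of at most as many orthonormal ones. -/
theorem exists_orthonormal_coordinates {E : Type*} [NormedAddCommGroup E] [InnerProductSpace ℝ E]
    {M : ℕ} (F : Fin M → E) :
    ∃ (r : ℕ) (b : Fin r → E) (a : Fin M → Fin r → ℝ), r ≤ M ∧ Orthonormal ℝ b ∧
      ∀ j, F j = ∑ k, a j k • b k := by
  have : FiniteDimensional ℝ (Submodule.span ℝ (Set.range F)) :=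
    FiniteDimensional.span_of_finite ℝ (Set.finite_range F)
  let b := stdOrthonormalBasis ℝ (Submodule.span ℝ (Set.range F))
  refine ⟨_, fun k => (b k : E), fun j => b.repr ⟨F j, Submodule.subset_span ⟨j, rfl⟩⟩,
    by simpa [Set.finrank] using finrank_range_le_card (R := ℝ) F,
    b.orthonormal.comp_linearIsometry (Submodule.subtypeₗᵢ _), fun j => ?_⟩
  have h := congrArg Subtype.val (b.sum_repr ⟨F j, Submodule.subset_span ⟨j, rfl⟩⟩)
  rw [Submodule.coe_sum] at h
  exact h.symm

/-- Reduces all `L₂` computations to `r ≤ M` coordinates, without assuming the `f j` independent.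
The expansion holds only almost everywhere, since the `e k` are representatives of `L₂` classes. -/
theorem exists_orthonormal_expansion {Ω : Type*} [MeasurableSpace Ω] (μ : Measure Ω) {M : ℕ}
    {f : Fin M → Ω → ℝ} (hf : ∀ j, MemLp (f j) 2 μ) :
    ∃ (r : ℕ) (e : Fin r → Ω → ℝ) (a : Fin M → Fin r → ℝ), r ≤ M ∧ (∀ k, MemLp (e k) 2 μ) ∧
      (∀ k l, ∫ x, e k x * e l x ∂μ = if k = l then 1 else 0) ∧
      ∀ j, f j =ᵐ[μ] fun x => ∑ k, a j k * e k x := by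
  obtain ⟨r, b, a, hr, hb, hF⟩ := exists_orthonormal_coordinates fun j => (hf j).toLp (f j)
  refine ⟨r, fun k => b k, a, hr, fun k => Lp.memLp _, fun k l => ?_, fun j => ?_⟩
  · have h := orthonormal_iff_ite.1 hb l k
    rw [L2.inner_def] at h
    simpa [eq_comm] using h
  · have h1 := (hf j).coeFn_toLp
    rw [hF j] at h1
    have h2 : ∀ᵐ x ∂μ, ∀ k, (a j k • b k : Lp ℝ 2 μ) x = a j k * b k x := by
      refine ae_all_iff.2 fun k => ?_
      filter_upwards [Lp.coeFn_smul (a j k) (b k)] with x hx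
      rw [hx, Pi.smul_apply, smul_eq_mul]
    filter_upwards [h1, h2, Lp.coeFn_fun_finsetSum Finset.univ fun k => a j k • b k] with x hx1 hx2 hx3
    rw [← hx1, hx3]
    exact Finset.sum_congr rfl fun k _ => hx2 k

/-- The mean squared error of an empirical mean. -/
theorem lintegral_empirical_mean_sq_le {Ω : Type*} [MeasurableSpace Ω] (μ : Measure Ω)
    [IsProbabilityMeasure μ] {e : Ω → ℝ} (he : MemLp e 2 μ) {K : ℝ}
    (hK : ∫ x, e x ^ 2 ∂μ ≤ K) {n : ℕ} (hn : 1 ≤ n) :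
    ∫⁻ X : Fin n → Ω, ENNReal.ofReal (((1 / (n : ℝ)) * ∑ i, e (X i) - ∫ x, e x ∂μ) ^ 2)
      ∂(Measure.pi fun _ => μ) ≤ ENNReal.ofReal (K / n) := by
  have hn0 : (0 : ℝ) < n := by exact_mod_cast hn
  set P := Measure.pi fun _ : Fin n => μ
  have hev : ∀ i, MemLp (fun X : Fin n → Ω => e (X i)) 2 P := fun i =>
    he.comp_measurePreserving (measurePreserving_eval (fun _ => μ) i)
  have hS : MemLp (∑ i, fun X : Fin n → Ω => e (X i)) 2 P := memLp_finsetSum' _ fun i _ => hev i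
  have hmean : ∫ X, (∑ i, fun X : Fin n → Ω => e (X i)) X ∂P = n * ∫ x, e x ∂μ := by
    simp_rw [Finset.sum_apply]
    rw [integral_finsetSum _ fun i _ => (hev i).integrable (by norm_num)]
    simp_rw [P, integral_comp_eval (μ := fun _ : Fin n => μ) he.1]
    simp
  have hvar := ProbabilityTheory.variance_sum_pi (μ := fun _ : Fin n => μ) (X := fun _ => e) fun _ => he
  have hv : ProbabilityTheory.variance e μ ≤ K :=
    (ProbabilityTheory.variance_le_expectation_sq he.1).trans (by simpa using hK)
  have hpt : ∀ X : Fin n → Ω, ((1 / (n : ℝ)) * ∑ i, e (X i) - ∫ x, e x ∂μ) ^ 2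
      = (1 / (n : ℝ)) ^ 2 * ((∑ i, fun X : Fin n → Ω => e (X i)) X
        - ∫ X, (∑ i, fun X : Fin n → Ω => e (X i)) X ∂P) ^ 2 := by
    intro X
    rw [hmean, Finset.sum_apply]
    field_simp
  simp_rw [hpt]
  rw [← ofReal_integral_eq_lintegral_ofReal]
  · refine ENNReal.ofReal_le_ofReal ?_
    rw [integral_const_mul, ← ProbabilityTheory.variance_eq_integral hS.1.aemeasurable, hvar]
    simp only [Finset.sum_const, Finset.card_univ, Fintype.card_fin, nsmul_eq_mul]
    calc (1 / (n : ℝ)) ^ 2 * (n * ProbabilityTheory.variance e μ)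
        = ProbabilityTheory.variance e μ / n := by field_simp
      _ ≤ K / n := by gcongr
  · exact ((hS.sub (memLp_const _)).integrable_sq).const_mul _
  · exact .of_forall fun X => by positivity

/-- The minimizer of a convex quadratic over a convex set, with the quadratic gap. -/
theorem quadratic_gap_of_isMinOn {E κ : Type*} [AddCommGroup E] [Module ℝ E] [Fintype κ]
    (c : E →ₗ[ℝ] κ → ℝ) (l : E →ₗ[ℝ] ℝ) {S : Set E} (hS : Convex ℝ S) {v w : E} (hv : v ∈ S)
    (hw : w ∈ S) (hmin : IsMinOn (fun u => ∑ k, c u k ^ 2 - l u) S v) :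
    ∑ k, c v k ^ 2 - l v + ∑ k, (c w k - c v k) ^ 2 ≤ ∑ k, c w k ^ 2 - l w := by
  -- Compare `v` with `(1 - t) v + t w`, divide by `t`, and later let `t → 0` to recover the full
  -- gap.
  have key : ∀ t : ℝ, 0 < t → t ≤ 1 →
      ∑ k, c v k ^ 2 - l v + (1 - t) * ∑ k, (c w k - c v k) ^ 2 ≤ ∑ k, c w k ^ 2 - l w := by
    intro t ht ht1
    have h := isMinOn_iff.1 hmin ((1 - t) • v + t • w) (hS hv hw (by linarith) ht.le (by ring))
    have hk : ∀ k, c ((1 - t) • v + t • w) k ^ 2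
        = (1 - t) * c v k ^ 2 + t * c w k ^ 2 - t * (1 - t) * (c w k - c v k) ^ 2 := by
      intro k
      simp only [map_add, map_smul, Pi.add_apply, Pi.smul_apply, smul_eq_mul]
      ring
    simp only [hk] at h
    simp only [map_add, map_smul, smul_eq_mul, Finset.sum_add_distrib, Finset.sum_sub_distrib,
      ← Finset.mul_sum] at h
    have h' : t * (∑ k, c v k ^ 2 - l v + (1 - t) * ∑ k, (c w k - c v k) ^ 2)
        ≤ t * (∑ k, c w k ^ 2 - l w) := by
      linear_combination h
    exact le_of_mul_le_mul_left h' ht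
  have hlim : Filter.Tendsto (fun t : ℝ => ∑ k, c v k ^ 2 - l v
      + (1 - t) * ∑ k, (c w k - c v k) ^ 2) (nhdsWithin 0 (Set.Ioi 0))
      (nhds (∑ k, c v k ^ 2 - l v + (1 - 0) * ∑ k, (c w k - c v k) ^ 2)) :=
    (Continuous.tendsto (by fun_prop) 0).mono_left nhdsWithin_le_nhds
  have := le_of_tendsto hlim (by
    filter_upwards [Ioc_mem_nhdsGT (zero_lt_one' ℝ)] with t ht using key t ht.1 ht.2)
  simpa using this

/-! ### The simplex and the criterion in coordinates. -/

theorem convex_simplex (M : ℕ) : Convex ℝ (simplex M) := by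
  intro v hv w hw a b ha hb hab
  refine ⟨fun j => ?_, ?_⟩
  · have := hv.1 j
    have := hw.1 j
    simp only [Pi.add_apply, Pi.smul_apply, smul_eq_mul]
    positivity
  · simp only [Pi.add_apply, Pi.smul_apply, smul_eq_mul, Finset.sum_add_distrib, ← Finset.mul_sum]
    nlinarith [hv.2, hw.2]

/-- The coefficients of `∑ j, w j * f j`, when `f j = ∑ k, a j k * e k`. -/
def coord {M r : ℕ} (a : Fin M → Fin r → ℝ) : (Fin M → ℝ) →ₗ[ℝ] Fin r → ℝ where
  toFun w k := ∑ j, w j * a j k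
  map_add' v w := by ext k; simp [add_mul, Finset.sum_add_distrib]
  map_smul' t w := by ext k; simp [Finset.mul_sum, mul_assoc]

/-- The linear form `w ↦ ∑ j, v j * w j`. -/
def dotForm {M : ℕ} (v : Fin M → ℝ) : (Fin M → ℝ) →ₗ[ℝ] ℝ where
  toFun w := ∑ j, v j * w j
  map_add' := by simp [mul_add, Finset.sum_add_distrib]
  map_smul' := by intro t w; simp only [Pi.smul_apply, smul_eq_mul, RingHom.id_apply,
                    Finset.mul_sum]; exact Finset.sum_congr rfl fun _ _ => by ring

theorem coord_apply {M r : ℕ} (a : Fin M → Fin r → ℝ) (w : Fin M → ℝ) (k : Fin r) :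
    coord a w k = ∑ j, w j * a j k := rfl

theorem dotForm_apply {M : ℕ} (v w : Fin M → ℝ) : dotForm v w = ∑ j, v j * w j := rfl

theorem sum_mul_sum_coord {M r : ℕ} (a : Fin M → Fin r → ℝ) (w : Fin M → ℝ) (y : Fin r → ℝ) :
    ∑ j, w j * ∑ k, a j k * y k = ∑ k, coord a w k * y k := by
  simp_rw [coord_apply, Finset.mul_sum, Finset.sum_mul]
  rw [Finset.sum_comm]
  simp_rw [mul_assoc]

theorem mix_ae_eq {d M r : ℕ} {f : Fin M → Pt d → ℝ} {e : Fin r → Pt d → ℝ}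
    {a : Fin M → Fin r → ℝ} (hfe : ∀ j, f j =ᵐ[volume] fun x => ∑ k, a j k * e k x)
    (w : Fin M → ℝ) : mix f w =ᵐ[volume] fun x => ∑ k, coord a w k * e k x := by
  filter_upwards [ae_all_iff.2 hfe] with x hx
  simp only [mix]
  rw [← sum_mul_sum_coord]
  exact Finset.sum_congr rfl fun j _ => by rw [hx j]

theorem integral_orthonormal_combination_sub_sq {Ω : Type*} [MeasurableSpace Ω] {μ : Measure Ω}
    {r : ℕ} {e : Fin r → Ω → ℝ} (he : ∀ k, MemLp (e k) 2 μ)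
    (ho : ∀ k l, ∫ x, e k x * e l x ∂μ = if k = l then 1 else 0) {p : Ω → ℝ} (hp : MemLp p 2 μ)
    (c : Fin r → ℝ) :
    ∫ x, (∑ k, c k * e k x - p x) ^ 2 ∂μ
      = ∑ k, c k ^ 2 - 2 * ∑ k, c k * ∫ x, e k x * p x ∂μ + ∫ x, p x ^ 2 ∂μ := by
  have h2 : ∀ k l, Integrable (fun x => e k x * e l x) μ := fun k l =>
    (he k).integrable_mul (he l)
  have h1 : ∀ k, Integrable (fun x => e k x * p x) μ := fun k => (he k).integrable_mul hp
  have hx : ∀ x, (∑ k, c k * e k x - p x) ^ 2 = ∑ k, ∑ l, c k * c l * (e k x * e l x)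
      - 2 * ∑ k, c k * (e k x * p x) + p x ^ 2 := by
    intro x
    rw [sub_sq, sq (∑ k, c k * e k x), Finset.sum_mul_sum, mul_assoc, Finset.sum_mul]
    have h3 : ∑ k, ∑ l, c k * e k x * (c l * e l x) = ∑ k, ∑ l, c k * c l * (e k x * e l x) :=
      Finset.sum_congr rfl fun k _ => Finset.sum_congr rfl fun l _ => by ring
    simp_rw [h3, mul_assoc]
  simp_rw [hx]
  have i2 : Integrable (fun x => ∑ k, ∑ l, c k * c l * (e k x * e l x)) μ :=
    integrable_finsetSum _ fun k _ => integrable_finsetSum _ fun l _ => (h2 k l).const_mul _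
  have i1 : Integrable (fun x => 2 * ∑ k, c k * (e k x * p x)) μ :=
    (integrable_finsetSum _ fun k _ => (h1 k).const_mul _).const_mul _
  have i3 : Integrable (fun x => ∑ k, ∑ l, c k * c l * (e k x * e l x)
      - 2 * ∑ k, c k * (e k x * p x)) μ := i2.sub i1
  rw [integral_add i3 hp.integrable_sq, integral_sub i2 i1, integral_const_mul,
    integral_finsetSum _ fun k _ => (h1 k).const_mul _,
    integral_finsetSum _ fun k _ => integrable_finsetSum _ fun l _ => (h2 k l).const_mul _]
  congr 2
  · refine Finset.sum_congr rfl fun k _ => ?_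
    rw [integral_finsetSum _ fun l _ => (h2 k l).const_mul _]
    simp_rw [integral_const_mul, ho]
    simp [sq]
  · simp_rw [integral_const_mul]

theorem memLp_two_mix {d M : ℕ} {f : Fin M → Pt d → ℝ} (hf : ∀ j, MemLp (f j) 2 volume)
    (w : Fin M → ℝ) : MemLp (mix f w) 2 volume :=
  memLp_finsetSum _ fun j _ => (hf j).const_mul _

/-- The linear term keeps the values `f j (X i)` instead of expanding them in `e k (X i)`: the
identity must hold for every sample, while the expansion may fail on a null set. -/
theorem criterion_eq {d M n r : ℕ} {f : Fin M → Pt d → ℝ} {e : Fin r → Pt d → ℝ}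
    {a : Fin M → Fin r → ℝ} (he : ∀ k, MemLp (e k) 2 volume)
    (ho : ∀ k l, ∫ x, e k x * e l x = if k = l then 1 else 0)
    (hfe : ∀ j, f j =ᵐ[volume] fun x => ∑ k, a j k * e k x) (X : Fin n → Pt d) (w : Fin M → ℝ) :
    criterion f X w
      = ∑ k, coord a w k ^ 2 - dotForm (fun j => 2 / (n : ℝ) * ∑ i, f j (X i)) w := by
  have h1 : ∫ x, mix f w x ^ 2 = ∑ k, coord a w k ^ 2 := by
    have := integral_orthonormal_combination_sub_sq he ho (p := 0) MemLp.zero (coord a w)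
    simp only [Pi.zero_apply, sub_zero, mul_zero, integral_zero, Finset.sum_const_zero,
      ne_eq, OfNat.ofNat_ne_zero, not_false_eq_true, zero_pow, add_zero] at this
    rw [← this]
    refine integral_congr_ae ?_
    filter_upwards [mix_ae_eq hfe w] with x hx
    rw [hx]
  rw [criterion, h1, dotForm_apply]
  congr 1
  simp only [mix]
  rw [Finset.sum_comm, Finset.mul_sum]
  refine Finset.sum_congr rfl fun j _ => ?_
  rw [← Finset.mul_sum]
  ring

/-! ### Bounded densities and the law of one observation. -/

section Density

variable {d : ℕ} {L : ℝ} {p : Pt d → ℝ}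

theorem integrable_of_mem (hp : p ∈ boundedDensities d L) : Integrable p := by
  by_contra h
  have := hp.2.1
  rw [integral_undef h] at this
  exact zero_ne_one this

theorem ae_le_of_mem (hL : 0 < L) (hp : p ∈ boundedDensities d L) : ∀ᵐ x, p x ≤ L := by
  have h := hp.2.2
  rw [eLpNorm_exponent_top] at h
  filter_upwards [ae_le_eLpNormEssSup (f := p) (μ := volume)] with x hx
  have h1 := hx.trans h
  rw [Real.enorm_eq_ofReal (hp.1 x)] at h1
  exact (ENNReal.ofReal_le_ofReal_iff hL.le).1 h1

theorem memLp_two_of_mem (hL : 0 < L) (hp : p ∈ boundedDensities d L) : MemLp p 2 volume := by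
  have hi := integrable_of_mem hp
  refine (memLp_two_iff_integrable_sq hi.1).2 (Integrable.mono (hi.const_mul L) (hi.1.pow 2) ?_)
  filter_upwards [ae_le_of_mem hL hp] with x hx
  have := hp.1 x
  rw [Real.norm_of_nonneg (by positivity), Real.norm_of_nonneg (by positivity), sq]
  gcongr

/-- The distribution of one observation. -/
noncomputable def obsLaw (p : Pt d → ℝ) : Measure (Pt d) :=
  volume.withDensity fun x => ENNReal.ofReal (p x)

theorem obsLaw_absolutelyContinuous (p : Pt d → ℝ) : obsLaw p ≪ volume :=
  withDensity_absolutelyContinuous _ _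

theorem isProbabilityMeasure_obsLaw (hp : p ∈ boundedDensities d L) :
    IsProbabilityMeasure (obsLaw p) := by
  refine ⟨?_⟩
  rw [obsLaw, withDensity_apply _ MeasurableSet.univ, setLIntegral_univ,
    ← ofReal_integral_eq_lintegral_ofReal (integrable_of_mem hp) (.of_forall hp.1), hp.2.1,
    ENNReal.ofReal_one]

theorem integral_obsLaw (hp : p ∈ boundedDensities d L) (g : Pt d → ℝ) :
    ∫ x, g x ∂(obsLaw p) = ∫ x, g x * p x := by
  rw [obsLaw, integral_withDensity_eq_integral_toReal_smul₀
    (integrable_of_mem hp).1.aemeasurable.ennreal_ofReal (.of_forall fun _ => ENNReal.ofReal_lt_top)]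
  refine integral_congr_ae (.of_forall fun x => ?_)
  simp [ENNReal.toReal_ofReal (hp.1 x), mul_comm]

theorem obsLaw_le (hL : 0 < L) (hp : p ∈ boundedDensities d L) :
    obsLaw p ≤ ENNReal.ofReal L • volume := by
  rw [obsLaw, ← withDensity_const]
  refine withDensity_mono ?_
  filter_upwards [ae_le_of_mem hL hp] with x hx using ENNReal.ofReal_le_ofReal hx

theorem memLp_obsLaw (hL : 0 < L) (hp : p ∈ boundedDensities d L) {g : Pt d → ℝ}
    (hg : MemLp g 2 volume) : MemLp g 2 (obsLaw p) :=
  hg.of_measure_le_smul ENNReal.ofReal_ne_top (obsLaw_le hL hp)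

/-- Source of the factor `L` in the upper bound: a unit vector of `L₂` has second moment at most `L`
under `p`. -/
theorem integral_sq_obsLaw_le (hL : 0 < L) (hp : p ∈ boundedDensities d L) {g : Pt d → ℝ}
    (hg : MemLp g 2 volume) : ∫ x, g x ^ 2 ∂(obsLaw p) ≤ L * ∫ x, g x ^ 2 := by
  rw [integral_obsLaw hp, ← integral_const_mul]
  refine integral_mono_of_nonneg (.of_forall fun x => mul_nonneg (sq_nonneg _) (hp.1 x))
    (hg.integrable_sq.const_mul _) ?_
  filter_upwards [ae_le_of_mem hL hp] with x hx
  rw [mul_comm]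
  gcongr

end Density

/-! ### The upper bound for convex aggregates. -/

theorem sqDist_eq_ofReal {d : ℕ} {g p : Pt d → ℝ} (hg : MemLp g 2 volume) (hp : MemLp p 2 volume) :
    sqDist g p = ENNReal.ofReal (∫ x, (g x - p x) ^ 2) :=
  (ofReal_integral_eq_lintegral_ofReal (hg.sub hp).integrable_sq
    (.of_forall fun _ => sq_nonneg _)).symm

theorem ae_sampleLaw {d n : ℕ} {L : ℝ} {p : Pt d → ℝ} (hp : p ∈ boundedDensities d L)
    {q : Pt d → Prop} (hq : ∀ᵐ x, q x) : ∀ᵐ X ∂(sampleLaw n p), ∀ i, q (X i) := by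
  have := isProbabilityMeasure_obsLaw hp
  refine ae_all_iff.2 fun i => ?_
  exact (Measure.quasiMeasurePreserving_eval (fun _ : Fin n => obsLaw p) i).ae
    ((obsLaw_absolutelyContinuous p).ae_le hq)

/-- With `Δ` the coordinates of `u X` minus those of `w`, the quadratic gap bounds the difference of
the losses by `2⟨Δ, η⟩ - |Δ|²`, which is at most `|η|²`. The oracle term thus keeps the constant
one. -/
theorem risk_convexAggregate_le {d M n : ℕ} {L : ℝ} (hL : 0 < L) (hn : 1 ≤ n)
    {f : Fin M → Pt d → ℝ} (hf : ∀ j, MemLp (f j) 2 volume) {T : (Fin n → Pt d) → Pt d → ℝ}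
    (hT : IsConvexAggregate (simplex M) f T) {p : Pt d → ℝ} (hp : p ∈ boundedDensities d L)
    {w : Fin M → ℝ} (hw : w ∈ simplex M) :
    risk T p ≤ sqDist (mix f w) p + ENNReal.ofReal (L * M / n) := by
  obtain ⟨u, -, hu⟩ := hT
  obtain ⟨r, e, a, hr, he, ho, hfe⟩ := exists_orthonormal_expansion volume hf
  have hp2 := memLp_two_of_mem hL hp
  have hprob := isProbabilityMeasure_obsLaw hp
  have hn0 : (0 : ℝ) < n := by exact_mod_cast hn
  set η : (Fin n → Pt d) → Fin r → ℝ := fun X k =>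
    (1 / (n : ℝ)) * ∑ i, e k (X i) - ∫ x, e k x ∂(obsLaw p) with hη
  have hdist : ∀ v : Fin M → ℝ, ∫ x, (mix f v x - p x) ^ 2
      = ∑ k, coord a v k ^ 2 - 2 * ∑ k, coord a v k * ∫ x, e k x ∂(obsLaw p) + ∫ x, p x ^ 2 := by
    intro v
    simp_rw [integral_obsLaw hp]
    rw [← integral_orthonormal_combination_sub_sq he ho hp2]
    refine integral_congr_ae ?_
    filter_upwards [mix_ae_eq hfe v] with x hx
    rw [hx]
  have hpt : ∀ᵐ X ∂(sampleLaw n p),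
      sqDist (T X) p ≤ sqDist (mix f w) p + ∑ k, ENNReal.ofReal (η X k ^ 2) := by
    filter_upwards [ae_sampleLaw hp (ae_all_iff.2 hfe)] with X hX
    obtain ⟨huS, humin, hTX⟩ := hu X
    have hmin : IsMinOn (fun v => ∑ k, coord a v k ^ 2
        - dotForm (fun j => 2 / (n : ℝ) * ∑ i, f j (X i)) v) (simplex M) (u X) := by
      simpa only [← criterion_eq he ho hfe X] using humin
    have hgap := quadratic_gap_of_isMinOn _ _ (convex_simplex M) huS hw hmin
    have hdot : ∀ v, dotForm (fun j => 2 / (n : ℝ) * ∑ i, f j (X i)) v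
        = 2 * ∑ k, coord a v k * ((1 / (n : ℝ)) * ∑ i, e k (X i)) := by
      intro v
      rw [dotForm_apply, ← sum_mul_sum_coord, Finset.mul_sum]
      refine Finset.sum_congr rfl fun j _ => ?_
      have : ∑ i, f j (X i) = ∑ k, a j k * ∑ i, e k (X i) := by
        simp_rw [Finset.mul_sum]
        rw [Finset.sum_comm]
        exact Finset.sum_congr rfl fun i _ => hX i j
      rw [this]
      simp_rw [mul_left_comm _ (1 / (n : ℝ)), ← Finset.mul_sum]
      ring
    rw [hdot, hdot] at hgap
    rw [hTX, sqDist_eq_ofReal (memLp_two_mix hf _) hp2, sqDist_eq_ofReal (memLp_two_mix hf _) hp2,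
      ← ENNReal.ofReal_sum_of_nonneg fun k _ => sq_nonneg _,
      ← ENNReal.ofReal_add (integral_nonneg fun x => sq_nonneg _)
        (Finset.sum_nonneg fun k _ => sq_nonneg _)]
    refine ENNReal.ofReal_le_ofReal ?_
    rw [hdist, hdist]
    -- Completing this square removes the cross term between the weights and the noise.
    have hsq : 0 ≤ ∑ k, ((coord a w k - coord a (u X) k) + η X k) ^ 2 :=
      Finset.sum_nonneg fun k _ => sq_nonneg _
    have hexp : ∀ c v y q : Fin r → ℝ, ∑ k, ((c k - v k) + (y k - q k)) ^ 2
        = ∑ k, (c k - v k) ^ 2 + ∑ k, (y k - q k) ^ 2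
          + 2 * (∑ k, c k * y k - ∑ k, c k * q k) - 2 * (∑ k, v k * y k - ∑ k, v k * q k) := by
      intro c v y q
      simp_rw [← Finset.sum_sub_distrib, Finset.mul_sum, ← Finset.sum_add_distrib,
        ← Finset.sum_sub_distrib]
      exact Finset.sum_congr rfl fun k _ => by ring
    rw [hη, hexp] at hsq
    rw [hη]
    linarith
  have : IsProbabilityMeasure (sampleLaw n p) :=
    inferInstanceAs (IsProbabilityMeasure (Measure.pi fun _ : Fin n => obsLaw p))
  have hmeas : ∀ k, AEMeasurable (fun X => ENNReal.ofReal (η X k ^ 2)) (sampleLaw n p) := by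
    intro k
    refine AEMeasurable.ennreal_ofReal (AEMeasurable.pow_const (AEMeasurable.sub_const
      (AEMeasurable.const_mul (Finset.aemeasurable_fun_sum _ fun i _ => ?_) _) _) _)
    exact (memLp_obsLaw hL hp (he k)).1.aemeasurable.comp_quasiMeasurePreserving
      (Measure.quasiMeasurePreserving_eval (fun _ : Fin n => obsLaw p) i)
  calc risk T p ≤ ∫⁻ X, sqDist (mix f w) p + ∑ k, ENNReal.ofReal (η X k ^ 2) ∂(sampleLaw n p) :=
        lintegral_mono_ae hpt
    _ = sqDist (mix f w) p + ∑ k, ∫⁻ X, ENNReal.ofReal (η X k ^ 2) ∂(sampleLaw n p) := by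
        rw [lintegral_add_left measurable_const, lintegral_const, measure_univ, mul_one,
          lintegral_finsetSum' _ fun k _ => hmeas k]
    _ ≤ sqDist (mix f w) p + ∑ k : Fin r, ENNReal.ofReal (L / n) := by
        gcongr with k
        refine lintegral_empirical_mean_sq_le (obsLaw p) (memLp_obsLaw hL hp (he k)) ?_ hn
        refine (integral_sq_obsLaw_le hL hp (he k)).trans ?_
        have := ho k k
        simp_rw [sq, this]
        simp
    _ ≤ _ := by
        gcongr
        rw [Finset.sum_const, Finset.card_univ, Fintype.card_fin, nsmul_eq_mul,
          ← ENNReal.ofReal_natCast, ← ENNReal.ofReal_mul (by positivity)]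
        refine ENNReal.ofReal_le_ofReal ?_
        have : (r : ℝ) ≤ M := by exact_mod_cast hr
        calc (r : ℝ) * (L / n) ≤ M * (L / n) := by gcongr
          _ = L * M / n := by ring

theorem isEstimator_of_isConvexAggregate {d M n : ℕ} {S : Set (Fin M → ℝ)} {f : Fin M → Pt d → ℝ}
    (hf : ∀ j, MemLp (f j) 2 volume) {T : (Fin n → Pt d) → Pt d → ℝ}
    (hT : IsConvexAggregate S f T) : IsEstimator T := by
  obtain ⟨u, hum, hu⟩ := hT
  have : Function.uncurry T = fun z => ∑ j, u z.1 j * f j z.2 := by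
    funext z
    simp only [Function.uncurry_def, (hu z.1).2.2, mix]
  rw [IsEstimator, this, Measure.volume_eq_prod]
  refine Finset.aemeasurable_fun_sum _ fun j _ => AEMeasurable.mul ?_ ?_
  · exact ((measurable_pi_apply j).comp_aemeasurable hum).comp_quasiMeasurePreserving
      Measure.quasiMeasurePreserving_fst
  · exact (hf j).1.aemeasurable.comp_quasiMeasurePreserving Measure.quasiMeasurePreserving_snd

theorem maxExcessRisk_convexAggregate_le {d M n : ℕ} {L : ℝ} (hL : 0 < L) (hn : 1 ≤ n)
    {f : Fin M → Pt d → ℝ} (hf : ∀ j, MemLp (f j) 2 volume) {T : (Fin n → Pt d) → Pt d → ℝ}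
    (hT : IsConvexAggregate (simplex M) f T) :
    maxExcessRisk (boundedDensities d L) (simplex M) f T ≤ ((L * M / n : ℝ) : EReal) := by
  refine iSup₂_le fun p hp => ?_
  have h : risk T p ≤ (⨅ w ∈ simplex M, sqDist (mix f w) p) + ENNReal.ofReal (L * M / n) := by
    simp_rw [ENNReal.iInf_add]
    exact le_iInf₂ fun w hw => risk_convexAggregate_le hL hn hf hT hp hw
  have h' : (risk T p : EReal) ≤ ((⨅ w ∈ simplex M, sqDist (mix f w) p : ℝ≥0∞) : EReal)
      + ((L * M / n : ℝ) : EReal) := by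
    rw [← max_eq_left (a := L * M / n) (b := 0) (by positivity), ← EReal.coe_ennreal_ofReal, ← EReal.coe_ennreal_add]
    exact EReal.coe_ennreal_le_coe_ennreal_iff.2 h
  refine EReal.sub_le_of_le_add ?_
  rwa [add_comm]

/-! ### Existence of a measurable minimizer by vanishing ridge regularization. -/

theorem isClosed_simplex (M : ℕ) : IsClosed (simplex M) := by
  have h : simplex M = (⋂ j, {w | 0 ≤ w j}) ∩ {w | ∑ j, w j ≤ 1} := by
    ext w; simp [simplex]
  rw [h]
  exact (isClosed_iInter fun j => isClosed_le continuous_const (continuous_apply j)).inter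
    (isClosed_le (by fun_prop) continuous_const)

theorem mem_Icc_of_mem_simplex {M : ℕ} {w : Fin M → ℝ} (hw : w ∈ simplex M) (j : Fin M) :
    w j ∈ Set.Icc (0 : ℝ) 1 :=
  ⟨hw.1 j, (Finset.single_le_sum (fun i _ => hw.1 i) (Finset.mem_univ j)).trans hw.2⟩

theorem isCompact_simplex (M : ℕ) : IsCompact (simplex M) :=
  (isCompact_univ_pi fun _ => isCompact_Icc).of_isClosed_subset (isClosed_simplex M)
    fun _ hw j _ => mem_Icc_of_mem_simplex hw j

theorem zero_mem_simplex (M : ℕ) : (0 : Fin M → ℝ) ∈ simplex M := ⟨fun _ => le_rfl, by simp⟩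

/-- The regularized form: the coordinates of `w` followed by the entries of `√ε w`. -/
def ridgeCoord {M r : ℕ} (c : (Fin M → ℝ) →ₗ[ℝ] Fin r → ℝ) (s : ℝ) :
    (Fin M → ℝ) →ₗ[ℝ] Fin r ⊕ Fin M → ℝ where
  toFun w := Sum.elim (c w) (s • w)
  map_add' v w := by ext (k | k) <;> simp
  map_smul' t w := by ext (k | k) <;> simp [mul_left_comm]

theorem sum_ridgeCoord_sq {M r : ℕ} (c : (Fin M → ℝ) →ₗ[ℝ] Fin r → ℝ) (s : ℝ) (w : Fin M → ℝ) :
    ∑ k, ridgeCoord c s w k ^ 2 = ∑ k, c w k ^ 2 + s ^ 2 * ∑ j, w j ^ 2 := by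
  simp [ridgeCoord, Finset.mul_sum, mul_pow]

/-- The ridge criterion. -/
def ridge {M r : ℕ} (c : (Fin M → ℝ) →ₗ[ℝ] Fin r → ℝ) (ε : ℝ) (v w : Fin M → ℝ) : ℝ :=
  ∑ k, c w k ^ 2 - dotForm v w + ε * ∑ j, w j ^ 2

theorem continuous_ridge {M r : ℕ} (c : (Fin M → ℝ) →ₗ[ℝ] Fin r → ℝ) (ε : ℝ) (v : Fin M → ℝ) :
    Continuous (ridge c ε v) := by
  have h1 : Continuous c := c.continuous_of_finiteDimensional
  have h2 : Continuous (dotForm v) := (dotForm v).continuous_of_finiteDimensional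
  have h3 : ∀ k, Continuous fun w => c w k := fun k => (continuous_apply k).comp h1
  unfold ridge
  fun_prop

/-- The ridge criterion is again a sum of squares minus a linear form, so the quadratic gap applies.
Only the ridge part of the gap is kept: `c` need not be injective, and this part controls `w`
itself. -/
theorem ridge_gap {M r : ℕ} (c : (Fin M → ℝ) →ₗ[ℝ] Fin r → ℝ) {ε : ℝ} (hε : 0 ≤ ε)
    (v : Fin M → ℝ) {u w : Fin M → ℝ} (hu : u ∈ simplex M) (hw : w ∈ simplex M)
    (hmin : IsMinOn (ridge c ε v) (simplex M) u) :
    ridge c ε v u + ε * ∑ j, (w j - u j) ^ 2 ≤ ridge c ε v w := by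
  have hr : ∀ w, ∑ k, ridgeCoord c (√ε) w k ^ 2 - dotForm v w = ridge c ε v w := by
    intro w
    rw [sum_ridgeCoord_sq, Real.sq_sqrt hε, ridge]
    ring
  have h := quadratic_gap_of_isMinOn (ridgeCoord c (√ε)) (dotForm v) (convex_simplex M) hu hw
    (by simpa only [hr] using hmin)
  have hd : ∑ k, (ridgeCoord c (√ε) w k - ridgeCoord c (√ε) u k) ^ 2
      = ∑ k, (c (w - u)) k ^ 2 + ε * ∑ j, (w j - u j) ^ 2 := by
    have := sum_ridgeCoord_sq c (√ε) (w - u)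
    rw [Real.sq_sqrt hε] at this
    simpa [map_sub] using this
  rw [hr, hr, hd] at h
  have : 0 ≤ ∑ k, (c (w - u)) k ^ 2 := Finset.sum_nonneg fun k _ => sq_nonneg _
  linarith

theorem ridge_sub_ridge {M r : ℕ} (c : (Fin M → ℝ) →ₗ[ℝ] Fin r → ℝ) (ε : ℝ) (v v' w : Fin M → ℝ) :
    ridge c ε v' w = ridge c ε v w + ∑ j, (v j - v' j) * w j := by
  simp only [ridge, dotForm_apply, sub_mul, Finset.sum_sub_distrib]
  ring

/-- Ridge minimizers depend continuously on the linear term. -/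
theorem continuous_ridge_minimizer {M r : ℕ} (c : (Fin M → ℝ) →ₗ[ℝ] Fin r → ℝ) {ε : ℝ}
    (hε : 0 < ε) {u : (Fin M → ℝ) → Fin M → ℝ} (hu : ∀ v, u v ∈ simplex M)
    (hmin : ∀ v, IsMinOn (ridge c ε v) (simplex M) (u v)) : Continuous u := by
  -- Add the gap inequalities at `v` and at `v'`: the quadratic parts cancel, and the linear
  -- remainder is small because weights lie in `[0, 1]`.
  have hbound : ∀ v v' j, (u v' j - u v j) ^ 2 ≤ (∑ i, |v i - v' i|) / ε := by
    intro v v' j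
    have h1 := ridge_gap c hε.le v (hu v) (hu v') (hmin v)
    have h2 := ridge_gap c hε.le v' (hu v') (hu v) (hmin v')
    rw [ridge_sub_ridge c ε v v', ridge_sub_ridge c ε v v'] at h2
    have h3 : ∑ i, (v i - v' i) * u v i - ∑ i, (v i - v' i) * u v' i ≤ ∑ i, |v i - v' i| := by
      rw [← Finset.sum_sub_distrib]
      refine Finset.sum_le_sum fun i _ => ?_
      rw [← mul_sub]
      refine (le_abs_self _).trans ?_
      rw [abs_mul]
      refine mul_le_of_le_one_right (abs_nonneg _) ?_
      have ha := mem_Icc_of_mem_simplex (hu v) i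
      have hb := mem_Icc_of_mem_simplex (hu v') i
      rw [abs_le]
      constructor <;> linarith [ha.1, ha.2, hb.1, hb.2]
    have h4 : 0 ≤ ε * ∑ i, (u v i - u v' i) ^ 2 :=
      mul_nonneg hε.le (Finset.sum_nonneg fun i _ => sq_nonneg _)
    have h5 : (u v' j - u v j) ^ 2 ≤ ∑ i, (u v' i - u v i) ^ 2 :=
      Finset.single_le_sum (f := fun i => (u v' i - u v i) ^ 2) (fun i _ => sq_nonneg _)
        (Finset.mem_univ j)
    rw [le_div_iff₀ hε]
    nlinarith
  refine continuous_pi fun j => continuous_iff_continuousAt.2 fun v => ?_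
  rw [ContinuousAt, tendsto_iff_dist_tendsto_zero]
  have hlim : Filter.Tendsto (fun v' => √((∑ i, |v i - v' i|) / ε)) (nhds v) (nhds 0) := by
    have : Continuous fun v' : Fin M → ℝ => √((∑ i, |v i - v' i|) / ε) := by fun_prop
    simpa using this.tendsto v
  refine squeeze_zero (fun _ => dist_nonneg) (fun v' => ?_) hlim
  rw [Real.dist_eq]
  exact Real.abs_le_sqrt (hbound v v' j)

/-- Ridge minimizers converge as the regularization vanishes. -/
theorem exists_tendsto_ridge_minimizer {M r : ℕ} (c : (Fin M → ℝ) →ₗ[ℝ] Fin r → ℝ)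
    (v : Fin M → ℝ) {ε : ℕ → ℝ} (hpos : ∀ k, 0 < ε k) (hanti : StrictAnti ε)
    {u : ℕ → Fin M → ℝ} (hu : ∀ k, u k ∈ simplex M)
    (hmin : ∀ k, IsMinOn (ridge c (ε k) v) (simplex M) (u k)) :
    ∃ w, Filter.Tendsto u Filter.atTop (nhds w) := by
  set N : ℕ → ℝ := fun k => ∑ j, u k j ^ 2 with hN
  -- Adding the gap inequalities at the levels `ε i > ε k` leaves only the ridge terms. Hence `N`
  -- increases; being bounded, it is Cauchy, and it controls the increments of `u`.
  have hstep : ∀ i k, i ≤ k → ∑ j, (u k j - u i j) ^ 2 ≤ N k - N i := by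
    intro i k hik
    rcases hik.eq_or_lt with rfl | hlt
    · simp
    have he := hanti hlt
    have h1 := ridge_gap c (hpos i).le v (hu i) (hu k) (hmin i)
    have h2 := ridge_gap c (hpos k).le v (hu k) (hu i) (hmin k)
    have hD : ∑ j, (u i j - u k j) ^ 2 = ∑ j, (u k j - u i j) ^ 2 :=
      Finset.sum_congr rfl fun j _ => by ring
    rw [hD] at h2
    simp only [ridge] at h1 h2
    have hD0 : 0 ≤ ∑ j, (u k j - u i j) ^ 2 := Finset.sum_nonneg fun j _ => sq_nonneg _
    have h3 : (ε i - ε k) * ∑ j, (u k j - u i j) ^ 2 ≤ (ε i - ε k) * (N k - N i) := by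
      simp only [hN]
      nlinarith [mul_nonneg (hpos k).le hD0]
    exact le_of_mul_le_mul_left h3 (by linarith)
  have hmono : Monotone N := fun i k hik =>
    sub_nonneg.1 ((Finset.sum_nonneg fun j _ => sq_nonneg _).trans (hstep i k hik))
  have hbdd : BddAbove (Set.range N) := by
    refine ⟨M, ?_⟩
    rintro _ ⟨k, rfl⟩
    calc N k ≤ ∑ _j : Fin M, (1 : ℝ) := Finset.sum_le_sum fun j _ => by
          have := mem_Icc_of_mem_simplex (hu k) j
          nlinarith [this.1, this.2]
      _ = M := by simp
  have hcau := (tendsto_atTop_ciSup hmono hbdd).cauchySeq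
  refine cauchySeq_tendsto_of_complete (Metric.cauchySeq_iff'.2 fun δ hδ => ?_)
  obtain ⟨K, hK⟩ := Metric.cauchySeq_iff'.1 hcau (δ ^ 2) (by positivity)
  refine ⟨K, fun k hk => (dist_pi_lt_iff hδ).2 fun j => ?_⟩
  have h1 := hK k hk
  rw [Real.dist_eq] at h1
  have h2 : (u k j - u K j) ^ 2 ≤ ∑ j, (u k j - u K j) ^ 2 :=
    Finset.single_le_sum (f := fun j => (u k j - u K j) ^ 2) (fun i _ => sq_nonneg _)
      (Finset.mem_univ j)
  have h3 := (h2.trans (hstep K k hk)).trans_lt ((le_abs_self _).trans_lt h1)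
  rw [Real.dist_eq]
  exact abs_lt_of_sq_lt_sq h3 hδ.le

/-- A Borel selection of the minimizers of a convex quadratic over the simplex. -/
theorem exists_measurable_minimizer {M r : ℕ} (c : (Fin M → ℝ) →ₗ[ℝ] Fin r → ℝ) :
    ∃ s : (Fin M → ℝ) → Fin M → ℝ, Measurable s ∧ ∀ v, s v ∈ simplex M ∧
      IsMinOn (fun w => ∑ k, c w k ^ 2 - dotForm v w) (simplex M) (s v) := by
  set ε : ℕ → ℝ := fun k => 1 / ((k : ℝ) + 1) with hεdef
  have hpos : ∀ k, 0 < ε k := fun k => Nat.one_div_pos_of_nat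
  have hanti : StrictAnti ε := fun i k hik => Nat.one_div_lt_one_div hik
  have hex : ∀ k v, ∃ w ∈ simplex M, IsMinOn (ridge c (ε k) v) (simplex M) w := fun k v =>
    (isCompact_simplex M).exists_isMinOn ⟨0, zero_mem_simplex M⟩ (continuous_ridge c _ v).continuousOn
  choose u hu hmin using hex
  -- A pointwise limit of maps continuous in `v` is Borel, and it minimizes the limiting criterion.
  choose s hs using fun v =>
    exists_tendsto_ridge_minimizer c v hpos hanti (fun k => hu k v) fun k => hmin k v
  have hε0 : Filter.Tendsto ε Filter.atTop (nhds 0) := tendsto_one_div_add_atTop_nhds_zero_nat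
  refine ⟨s, measurable_of_tendsto_metrizable (fun k =>
    (continuous_ridge_minimizer c (hpos k) (hu k) (hmin k)).measurable) (tendsto_pi_nhds.2 hs),
    fun v => ⟨(isClosed_simplex M).mem_of_tendsto (hs v) (.of_forall fun k => hu k v), ?_⟩⟩
  refine isMinOn_iff.2 fun w hw => ?_
  have hle : ∀ k, ridge c 0 v (u k v) ≤ ridge c (ε k) v w := by
    intro k
    refine le_trans ?_ (isMinOn_iff.1 (hmin k v) w hw)
    simp only [ridge, zero_mul]
    have : 0 ≤ ε k * ∑ j, u k v j ^ 2 :=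
      mul_nonneg (hpos k).le (Finset.sum_nonneg fun j _ => sq_nonneg _)
    linarith
  have hl := ((continuous_ridge c 0 v).tendsto (s v)).comp (hs v)
  have hr : Filter.Tendsto (fun k => ridge c (ε k) v w) Filter.atTop (nhds (ridge c 0 v w)) := by
    simp only [ridge]
    exact (hε0.mul_const _).const_add _
  simpa [ridge] using le_of_tendsto_of_tendsto' hl hr hle

theorem exists_isConvexAggregate {d M n : ℕ} {f : Fin M → Pt d → ℝ}
    (hf : ∀ j, MemLp (f j) 2 volume) :
    ∃ T : (Fin n → Pt d) → Pt d → ℝ, IsConvexAggregate (simplex M) f T := by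
  obtain ⟨r, e, a, -, he, ho, hfe⟩ := exists_orthonormal_expansion volume hf
  obtain ⟨s, hsm, hs⟩ := exists_measurable_minimizer (coord a)
  refine ⟨fun X => mix f (s fun j => 2 / (n : ℝ) * ∑ i, f j (X i)), _,
    hsm.comp_aemeasurable (aemeasurable_pi_lambda _ fun j => (Finset.aemeasurable_fun_sum _
      fun i _ => (hf j).1.aemeasurable.comp_quasiMeasurePreserving
        (Measure.quasiMeasurePreserving_eval (fun _ : Fin n => volume) i)).const_mul _),
    fun X => ⟨(hs _).1, ?_, rfl⟩⟩
  have : criterion f X = fun w => ∑ k, coord a w k ^ 2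
      - dotForm (fun j => 2 / (n : ℝ) * ∑ i, f j (X i)) w :=
    funext fun w => criterion_eq he ho hfe X w
  rw [this]
  exact (hs _).2

theorem exists_isConvexProcedure (d : ℕ) : ∃ A : Procedure d, IsConvexProcedure A := by
  classical
  refine ⟨fun M n f => if hf : ∀ j, MemLp (f j) 2 volume then
    (exists_isConvexAggregate (n := n) hf).choose else 0, fun M n _ _ f hf => ?_⟩
  beta_reduce
  rw [dif_pos hf]
  exact (exists_isConvexAggregate hf).choose_spec

/-! ### Disjoint cells and histograms. -/

theorem exists_disjoint_cells {ι : Type*} [Fintype ι] {d : ℕ} (hd : 1 ≤ d) {v : ℝ} (hv : 0 < v) :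
    ∃ B : ι → Set (Pt d), (∀ i, MeasurableSet (B i)) ∧ Pairwise (Function.onFun Disjoint B) ∧
      ∀ i, volume (B i) = ENNReal.ofReal v := by
  obtain ⟨d, rfl⟩ := Nat.exists_eq_add_of_le' hd
  let k : ι → ℕ := fun i => Fintype.equivFin ι i
  have hk : Function.Injective k := Fin.val_injective.comp (Fintype.equivFin ι).injective
  -- Consecutive intervals of length `v` on the first axis, unit intervals on the others; this is
  -- where `d ≥ 1` is needed.
  let I : ι → Fin (d + 1) → Set ℝ := fun i =>
    Fin.cons (Set.Ico (k i * v) ((k i + 1) * v)) fun _ => Set.Ico 0 1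
  refine ⟨fun i => Set.univ.pi (I i), fun i => MeasurableSet.univ_pi fun j => ?_,
    fun i j hij => ?_, fun i => ?_⟩
  · refine Fin.cases ?_ (fun _ => ?_) j
    · exact measurableSet_Ico
    · exact measurableSet_Ico
  · refine Set.disjoint_left.2 fun x hx hy => ?_
    have h1 : x 0 ∈ Set.Ico (k i * v) ((k i + 1) * v) := hx 0 (Set.mem_univ _)
    have h2 : x 0 ∈ Set.Ico (k j * v) ((k j + 1) * v) := hy 0 (Set.mem_univ _)
    have h3 : (k i : ℝ) < k j + 1 := lt_of_mul_lt_mul_right (h1.1.trans_lt h2.2) hv.le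
    have h4 : (k j : ℝ) < k i + 1 := lt_of_mul_lt_mul_right (h2.1.trans_lt h1.2) hv.le
    norm_cast at h3 h4
    exact hij (hk (by omega))
  · rw [volume_pi_pi, Fin.prod_univ_succ]
    simp only [I, Fin.cons_zero, Fin.cons_succ, Real.volume_Ico]
    rw [show ((k i : ℝ) + 1) * v - k i * v = v by ring]
    simp

section Histogram

variable {ι : Type*} [Fintype ι] {d : ℕ}

/-- The histogram with height `u i` on the cell `B i`. -/
noncomputable def hist (B : ι → Set (Pt d)) (u : ι → ℝ) (x : Pt d) : ℝ :=
  ∑ i, (B i).indicator (fun _ => u i) x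

variable {B : ι → Set (Pt d)} {v : ℝ}

theorem hist_of_mem (hB : Pairwise (Function.onFun Disjoint B)) (u : ι → ℝ) {i : ι} {x : Pt d}
    (hx : x ∈ B i) : hist B u x = u i := by
  rw [hist, Finset.sum_eq_single i, Set.indicator_of_mem hx]
  · exact fun j _ hj => Set.indicator_of_notMem (Set.disjoint_left.1 (hB hj.symm) hx) _
  · exact fun h => absurd (Finset.mem_univ i) h

theorem hist_of_forall_notMem (u : ι → ℝ) {x : Pt d} (hx : ∀ i, x ∉ B i) : hist B u x = 0 :=
  Finset.sum_eq_zero fun i _ => Set.indicator_of_notMem (hx i) _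

/-- Identities between histograms are checked on the cells. -/
theorem hist_cases (hB : Pairwise (Function.onFun Disjoint B)) (x : Pt d) :
    (∃ i, x ∈ B i ∧ ∀ u, hist B u x = u i) ∨ ∀ u, hist B u x = 0 := by
  by_cases h : ∃ i, x ∈ B i
  · obtain ⟨i, hi⟩ := h
    exact .inl ⟨i, hi, fun u => hist_of_mem hB u hi⟩
  · exact .inr fun u => hist_of_forall_notMem u (not_exists.1 h)

theorem measurable_hist (hm : ∀ i, MeasurableSet (B i)) (u : ι → ℝ) : Measurable (hist B u) :=
  Finset.measurable_fun_sum _ fun i _ => measurable_const.indicator (hm i)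

theorem memLp_hist (hm : ∀ i, MeasurableSet (B i)) (hvol : ∀ i, volume (B i) = ENNReal.ofReal v)
    (q : ℝ≥0∞) (u : ι → ℝ) : MemLp (hist B u) q volume :=
  memLp_finsetSum _ fun i _ => memLp_indicator_const q (hm i) _ (.inr (by simp [hvol i]))

theorem integral_hist (hm : ∀ i, MeasurableSet (B i)) (hv : 0 ≤ v)
    (hvol : ∀ i, volume (B i) = ENNReal.ofReal v) (u : ι → ℝ) :
    ∫ x, hist B u x = (∑ i, u i) * v := by
  simp only [hist]
  rw [integral_finsetSum, Finset.sum_mul]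
  · refine Finset.sum_congr rfl fun i _ => ?_
    rw [integral_indicator_const _ (hm i), measureReal_def, hvol, ENNReal.toReal_ofReal hv,
      smul_eq_mul, mul_comm]
  · intro i _
    exact memLp_one_iff_integrable.1
      (memLp_indicator_const 1 (hm i) _ (.inr (by simp [hvol i])))

theorem mix_hist {M : ℕ} (U : Fin M → ι → ℝ) (w : Fin M → ℝ)
    (hB : Pairwise (Function.onFun Disjoint B)) :
    mix (fun j => hist B (U j)) w = hist B fun i => ∑ j, w j * U j i := by
  funext x
  rcases hist_cases hB x with ⟨i, -, h⟩ | h <;> simp [mix, h]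

theorem hist_mem_boundedDensities (hm : ∀ i, MeasurableSet (B i))
    (hB : Pairwise (Function.onFun Disjoint B)) (hv : 0 ≤ v)
    (hvol : ∀ i, volume (B i) = ENNReal.ofReal v) {L : ℝ} (hL : 0 < L) {u : ι → ℝ}
    (hu : ∀ i, u i ∈ Set.Icc 0 L) (hsum : (∑ i, u i) * v = 1) :
    hist B u ∈ boundedDensities d L := by
  have h : ∀ x, hist B u x ∈ Set.Icc 0 L := by
    intro x
    rcases hist_cases hB x with ⟨i, -, h⟩ | h
    · rw [h]; exact hu i
    · rw [h]; exact ⟨le_rfl, hL.le⟩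
  refine ⟨fun x => (h x).1, (integral_hist hm hv hvol u).trans hsum, ?_⟩
  rw [eLpNorm_exponent_top]
  refine essSup_le_of_ae_le _ (.of_forall fun x => ?_)
  beta_reduce
  rw [Real.enorm_eq_ofReal (h x).1]
  exact ENNReal.ofReal_le_ofReal (h x).2

end Histogram

/-! ### The cube of tilted densities. -/

section Hypercube

variable {d m : ℕ}

/-- The sign of the two halves of a cell. -/
def halfSign (b : Bool) : ℝ := if b then 1 else -1

/-- Heights of the perturbed densities: pair `j` is tilted by `γ` when `σ j` is true. -/
noncomputable def tilt (L γ : ℝ) (σ : Fin m → Bool) (i : Fin m × Bool) : ℝ :=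
  L / 2 * (1 + if σ i.1 then γ * halfSign i.2 else 0)

/-- Likelihood ratio heights for switching on pair `j`. -/
noncomputable def tiltRatio (γ : ℝ) (j : Fin m) (i : Fin m × Bool) : ℝ :=
  if i.1 = j then γ * halfSign i.2 else 0

/-- The sign vector with entry `j` flipped. -/
def flip (j : Fin m) (σ : Fin m → Bool) : Fin m → Bool := Function.update σ j (!σ j)

theorem flip_involutive (j : Fin m) : Function.Involutive (flip j) := by
  intro σ
  simp [flip]

theorem tilt_mem_Icc {L γ : ℝ} (hL : 0 < L) (h0 : 0 ≤ γ) (h1 : γ ≤ 1) (σ : Fin m → Bool)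
    (i : Fin m × Bool) : tilt L γ σ i ∈ Set.Icc 0 L := by
  obtain ⟨j, b⟩ := i
  have : (1 + if σ j then γ * halfSign b else 0) ∈ Set.Icc (0 : ℝ) 2 := by
    constructor <;> cases σ j <;> cases b <;> simp [halfSign] <;> linarith
  exact ⟨mul_nonneg (by linarith) this.1, by simp only [tilt]; nlinarith [this.2]⟩

theorem sum_tilt (L γ : ℝ) (σ : Fin m → Bool) : ∑ i, tilt L γ σ i = L * m := by
  have h : ∀ j, tilt L γ σ (j, true) + tilt L γ σ (j, false) = L := by
    intro j
    simp only [tilt, halfSign]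
    split_ifs <;> (simp at *; try ring)
  simp [Fintype.sum_prod_type, h, mul_comm]

/-- Times the cell volume `v`, this is the second moment of the likelihood ratio, `1 + L γ² v` when
`L m v = 1`. Pair `j` is flat under `σ`, so the terms linear in `γ` cancel between its halves. -/
theorem sum_tilt_mul_sq {L γ : ℝ} {σ : Fin m → Bool} {j : Fin m} (hσ : σ j = false) :
    ∑ i, tilt L γ σ i * (1 + tiltRatio γ j i) ^ 2 = L * m + L * γ ^ 2 := by
  have h : ∀ l, tilt L γ σ (l, true) * (1 + tiltRatio γ j (l, true)) ^ 2
      + tilt L γ σ (l, false) * (1 + tiltRatio γ j (l, false)) ^ 2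
      = L + if l = j then L * γ ^ 2 else 0 := by
    intro l
    by_cases hl : l = j
    · subst hl
      simp only [tilt, tiltRatio, halfSign, hσ, if_true]
      simp
      ring
    · simp only [tilt, tiltRatio, halfSign, hl, if_false]
      split_ifs <;> (simp at *; try ring)
  simp [Fintype.sum_prod_type, h, Finset.sum_add_distrib, mul_comm]

theorem tilt_flip {L γ : ℝ} {σ : Fin m → Bool} {j : Fin m} (hσ : σ j = false)
    (i : Fin m × Bool) : tilt L γ (flip j σ) i = tilt L γ σ i * (1 + tiltRatio γ j i) := by
  obtain ⟨l, b⟩ := i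
  by_cases hl : l = j
  · subst hl
    simp [tilt, tiltRatio, flip, hσ]
  · simp [tilt, tiltRatio, flip, hl]

theorem sq_tilt_sub_tilt_flip {L γ : ℝ} (σ : Fin m → Bool) (j : Fin m) (b : Bool) :
    (tilt L γ σ (j, b) - tilt L γ (flip j σ) (j, b)) ^ 2 = L ^ 2 * γ ^ 2 / 4 := by
  cases h : σ j <;> cases b <;> simp [tilt, flip, halfSign, h] <;> ring

end Hypercube

/-! ### Assouad's argument. -/

/-- Pointwise `(t - p)² + (t - q)² ≥ (p - q)² / 2`: no `t` is close to both `p` and `q`. -/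
theorem lintegral_sq_sub_add_lintegral_sq_sub_ge {Ω : Type*} [MeasurableSpace Ω] {μ : Measure Ω}
    {t p q : Ω → ℝ} (ht : AEMeasurable t μ) (hp : AEMeasurable p μ) {D : ℝ}
    (hD : ∀ᵐ x ∂μ, D ≤ (p x - q x) ^ 2) :
    ENNReal.ofReal (D / 2) * μ Set.univ
      ≤ ∫⁻ x, ENNReal.ofReal ((t x - p x) ^ 2) ∂μ + ∫⁻ x, ENNReal.ofReal ((t x - q x) ^ 2) ∂μ := by
  have hm : AEMeasurable (fun x => ENNReal.ofReal ((t x - p x) ^ 2)) μ :=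
    ((ht.sub hp).pow_const 2).ennreal_ofReal
  rw [← lintegral_add_left' hm, ← lintegral_const]
  refine lintegral_mono_ae ?_
  filter_upwards [hD] with x hx
  rw [← ENNReal.ofReal_add (sq_nonneg _) (sq_nonneg _)]
  refine ENNReal.ofReal_le_ofReal ?_
  nlinarith [sq_nonneg ((t x - p x) + (t x - q x))]

section Assouad

variable {d m n : ℕ} {L γ v : ℝ} {B : Fin m × Bool → Set (Pt d)}

/-- The part of the loss on the `j`-th pair of cells. -/
noncomputable def pairLoss (B : Fin m × Bool → Set (Pt d)) (T : (Fin n → Pt d) → Pt d → ℝ)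
    (p : Pt d → ℝ) (j : Fin m) (X : Fin n → Pt d) : ℝ≥0∞ :=
  ∫⁻ x in B (j, true) ∪ B (j, false), ENNReal.ofReal ((T X x - p x) ^ 2)

theorem sum_pairLoss_le (hm : ∀ i, MeasurableSet (B i))
    (hB : Pairwise (Function.onFun Disjoint B)) (T : (Fin n → Pt d) → Pt d → ℝ) (p : Pt d → ℝ)
    (X : Fin n → Pt d) : ∑ j, pairLoss B T p j X ≤ sqDist (T X) p := by
  simp only [pairLoss]
  rw [← lintegral_biUnion_finset (s := Finset.univ)
    (t := fun j => B (j, true) ∪ B (j, false)) ?_ fun j _ => (hm _).union (hm _)]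
  · exact setLIntegral_le_lintegral _ _
  · intro i _ j _ hij
    have h : ∀ b b', Disjoint (B (i, b)) (B (j, b')) := fun b b' => hB (by simp [hij])
    simp only [Function.onFun, Set.disjoint_union_left, Set.disjoint_union_right]
    exact ⟨⟨h _ _, h _ _⟩, ⟨h _ _, h _ _⟩⟩

theorem sampleLaw_absolutelyContinuous {p : Pt d → ℝ} (hp : p ∈ boundedDensities d L)
    (hpm : Measurable p) : sampleLaw n p ≪ volume := by
  have : IsProbabilityMeasure (volume.withDensity fun x => ENNReal.ofReal (p x)) :=
    isProbabilityMeasure_obsLaw hp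
  rw [sampleLaw, pi_withDensity volume hpm.ennreal_ofReal]
  exact withDensity_absolutelyContinuous _ _

theorem aemeasurable_pairLoss {T : (Fin n → Pt d) → Pt d → ℝ} (hT : IsEstimator T)
    {p : Pt d → ℝ} (hpm : Measurable p) (j : Fin m) : AEMeasurable (pairLoss B T p j) volume := by
  refine AEMeasurable.lintegral_prod_right'
    (f := fun z : (Fin n → Pt d) × Pt d => ENNReal.ofReal ((T z.1 z.2 - p z.2) ^ 2)) ?_
  refine AEMeasurable.ennreal_ofReal (AEMeasurable.pow_const (AEMeasurable.sub ?_ ?_) 2)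
  · rw [IsEstimator, Measure.volume_eq_prod] at hT
    exact hT.mono_ac (Measure.AbsolutelyContinuous.rfl.prod Measure.restrict_le_self.absolutelyContinuous)
  · exact (hpm.comp measurable_snd).aemeasurable

theorem ae_aemeasurable_of_isEstimator {T : (Fin n → Pt d) → Pt d → ℝ} (hT : IsEstimator T) :
    ∀ᵐ X, AEMeasurable (T X) volume := by
  rw [IsEstimator, Measure.volume_eq_prod] at hT
  filter_upwards [hT.aestronglyMeasurable.prodMk_left] with X hX using hX.aemeasurable

theorem pairLoss_add_pairLoss_ge (hm : ∀ i, MeasurableSet (B i))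
    (hB : Pairwise (Function.onFun Disjoint B)) (hv : 0 ≤ v)
    (hvol : ∀ i, volume (B i) = ENNReal.ofReal v) {T : (Fin n → Pt d) → Pt d → ℝ}
    {X : Fin n → Pt d} (hX : AEMeasurable (T X) volume) (σ : Fin m → Bool) (j : Fin m) :
    ENNReal.ofReal (L ^ 2 * γ ^ 2 / 4 * v) ≤ pairLoss B T (hist B (tilt L γ σ)) j X
      + pairLoss B T (hist B (tilt L γ (flip j σ))) j X := by
  have h := lintegral_sq_sub_add_lintegral_sq_sub_ge (D := L ^ 2 * γ ^ 2 / 4)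
    (μ := volume.restrict (B (j, true) ∪ B (j, false))) hX.restrict
    (measurable_hist hm (tilt L γ σ)).aemeasurable (q := hist B (tilt L γ (flip j σ))) (by
      refine (ae_restrict_iff' ((hm _).union (hm _))).2 (.of_forall fun x hx => ?_)
      have : ∃ b, x ∈ B (j, b) := hx.elim (fun h => ⟨_, h⟩) fun h => ⟨_, h⟩
      obtain ⟨b, hb⟩ := this
      rw [hist_of_mem hB _ hb, hist_of_mem hB _ hb, sq_tilt_sub_tilt_flip])
  refine le_trans (le_of_eq ?_) h
  rw [Measure.restrict_apply_univ, measure_union (hB (by simp)) (hm _), hvol, hvol,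
    ← ENNReal.ofReal_add hv hv, ← ENNReal.ofReal_mul (by positivity)]
  congr 1
  ring

theorem hist_tilt_mem (hm : ∀ i, MeasurableSet (B i))
    (hB : Pairwise (Function.onFun Disjoint B)) (hv : 0 ≤ v)
    (hvol : ∀ i, volume (B i) = ENNReal.ofReal v) (hL : 0 < L) (h0 : 0 ≤ γ) (h1 : γ ≤ 1)
    (hLv : L * m * v = 1) (σ : Fin m → Bool) : hist B (tilt L γ σ) ∈ boundedDensities d L :=
  hist_mem_boundedDensities hm hB hv hvol hL (tilt_mem_Icc hL h0 h1 σ) (by rw [sum_tilt, hLv])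

/-- The base law is the one where pair `j` is flat: its likelihood ratio to the other is `1 ± γ` on
the pair. The opposite ratio `1 / (1 ± γ)` would be unbounded as `γ → 1`. -/
theorem pair_risk_ge_of_false (hm : ∀ i, MeasurableSet (B i))
    (hB : Pairwise (Function.onFun Disjoint B)) (hv : 0 ≤ v)
    (hvol : ∀ i, volume (B i) = ENNReal.ofReal v) (hL : 0 < L) (h0 : 0 ≤ γ) (h1 : γ ≤ 1)
    (hLv : L * m * v = 1) (hγ : (1 + L * γ ^ 2 * v) ^ n ≤ 2) {T : (Fin n → Pt d) → Pt d → ℝ}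
    (hT : IsEstimator T) {σ : Fin m → Bool} {j : Fin m} (hσ : σ j = false) :
    ENNReal.ofReal (L ^ 2 * γ ^ 2 / 4 * v) / 2
      ≤ ∫⁻ X, pairLoss B T (hist B (tilt L γ σ)) j X ∂(sampleLaw n (hist B (tilt L γ σ)))
        + ∫⁻ X, pairLoss B T (hist B (tilt L γ (flip j σ))) j X
          ∂(sampleLaw n (hist B (tilt L γ (flip j σ)))) := by
  set p := hist B (tilt L γ σ)
  set q := hist B (tilt L γ (flip j σ))
  set g := hist B (tiltRatio γ j)
  have hp : p ∈ boundedDensities d L := hist_tilt_mem hm hB hv hvol hL h0 h1 hLv σ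
  have hq : q ∈ boundedDensities d L := hist_tilt_mem hm hB hv hvol hL h0 h1 hLv _
  have hpm : Measurable p := measurable_hist hm _
  have hgm : Measurable g := measurable_hist hm _
  have hρm : Measurable fun x => ENNReal.ofReal (1 + g x) := (hgm.const_add 1).ennreal_ofReal
  have hpq : ∀ x, q x = p x * (1 + g x) := by
    intro x
    rcases hist_cases hB x with ⟨i, -, h⟩ | h
    · simp only [p, q, g, h, tilt_flip hσ]
    · simp only [p, q, g, h, zero_mul]
  have hlaw : obsLaw q = (obsLaw p).withDensity fun x => ENNReal.ofReal (1 + g x) := by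
    rw [obsLaw, obsLaw, ← withDensity_mul _ hpm.ennreal_ofReal hρm]
    congr 1
    funext x
    rw [hpq, ENNReal.ofReal_mul (hp.1 x), Pi.mul_apply]
  have : IsProbabilityMeasure (obsLaw p) := isProbabilityMeasure_obsLaw hp
  have hone : ∫⁻ x, ENNReal.ofReal (1 + g x) ∂(obsLaw p) = 1 := by
    have := (isProbabilityMeasure_obsLaw hq).measure_univ
    rwa [hlaw, withDensity_apply _ MeasurableSet.univ, setLIntegral_univ] at this
  have hg1 : ∀ x, 0 ≤ 1 + g x := by
    intro x
    rcases hist_cases hB x with ⟨⟨l, b⟩, -, h⟩ | h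
    · simp only [g, h, tiltRatio, halfSign]
      split_ifs <;> linarith
    · simp only [g, h]; norm_num
  have hsq : ∫⁻ x, ENNReal.ofReal (1 + g x) ^ 2 ∂(obsLaw p)
      = ENNReal.ofReal (1 + L * γ ^ 2 * v) := by
    have hprod : ∀ x, p x * (1 + g x) ^ 2
        = hist B (fun i => tilt L γ σ i * (1 + tiltRatio γ j i) ^ 2) x := by
      intro x
      rcases hist_cases hB x with ⟨i, -, h⟩ | h
      · simp only [p, g, h]
      · simp only [p, g, h, zero_mul]
    rw [obsLaw, lintegral_withDensity_eq_lintegral_mul _ hpm.ennreal_ofReal (hρm.pow_const 2)]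
    have hint := integral_hist hm hv hvol fun i => tilt L γ σ i * (1 + tiltRatio γ j i) ^ 2
    rw [sum_tilt_mul_sq hσ, add_mul, hLv] at hint
    rw [← hint, ofReal_integral_eq_lintegral_ofReal
      (memLp_one_iff_integrable.1 (memLp_hist hm hvol 1 _))
      (.of_forall fun x => by rw [← hprod]; exact mul_nonneg (hp.1 x) (sq_nonneg _))]
    refine lintegral_congr fun x => ?_
    rw [← hprod, Pi.mul_apply, ENNReal.ofReal_mul (hp.1 x), ENNReal.ofReal_pow (hg1 x)]
  have hac := sampleLaw_absolutelyContinuous (n := n) hp hpm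
  have h2 := two_point_bound (obsLaw p) hρm (fun x => ENNReal.ofReal_ne_top) hone (n := n)
    (by
      rw [hsq, ← ENNReal.ofReal_pow (by positivity)]
      exact (ENNReal.ofReal_le_ofReal hγ).trans_eq (by simp))
    ((aemeasurable_pairLoss (B := B) hT hpm j).mono_ac hac)
    (b := pairLoss B T q j) (δ := ENNReal.ofReal (L ^ 2 * γ ^ 2 / 4 * v)) ENNReal.ofReal_ne_top
    (by
      filter_upwards [hac.ae_le (ae_aemeasurable_of_isEstimator hT)] with X hX
      exact pairLoss_add_pairLoss_ge hm hB hv hvol hX σ j)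
  rw [← hlaw] at h2
  exact h2

theorem pair_risk_ge (hm : ∀ i, MeasurableSet (B i))
    (hB : Pairwise (Function.onFun Disjoint B)) (hv : 0 ≤ v)
    (hvol : ∀ i, volume (B i) = ENNReal.ofReal v) (hL : 0 < L) (h0 : 0 ≤ γ) (h1 : γ ≤ 1)
    (hLv : L * m * v = 1) (hγ : (1 + L * γ ^ 2 * v) ^ n ≤ 2) {T : (Fin n → Pt d) → Pt d → ℝ}
    (hT : IsEstimator T) (σ : Fin m → Bool) (j : Fin m) :
    ENNReal.ofReal (L ^ 2 * γ ^ 2 / 4 * v) / 2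
      ≤ ∫⁻ X, pairLoss B T (hist B (tilt L γ σ)) j X ∂(sampleLaw n (hist B (tilt L γ σ)))
        + ∫⁻ X, pairLoss B T (hist B (tilt L γ (flip j σ))) j X
          ∂(sampleLaw n (hist B (tilt L γ (flip j σ)))) := by
  cases hσ : σ j
  · exact pair_risk_ge_of_false hm hB hv hvol hL h0 h1 hLv hγ hT hσ
  · have h := pair_risk_ge_of_false hm hB hv hvol hL h0 h1 hLv hγ hT (σ := flip j σ) (j := j)
      (by simp [flip, hσ])
    rwa [flip_involutive j σ, add_comm] at h

/-- Assouad's bound over the hypercube of tilted densities. -/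
theorem exists_risk_ge (hm : ∀ i, MeasurableSet (B i))
    (hB : Pairwise (Function.onFun Disjoint B)) (hv : 0 ≤ v)
    (hvol : ∀ i, volume (B i) = ENNReal.ofReal v) (hL : 0 < L) (h0 : 0 ≤ γ) (h1 : γ ≤ 1)
    (hLv : L * m * v = 1) (hγ : (1 + L * γ ^ 2 * v) ^ n ≤ 2) {T : (Fin n → Pt d) → Pt d → ℝ}
    (hT : IsEstimator T) :
    ∃ σ : Fin m → Bool, ENNReal.ofReal (L * γ ^ 2 / 16) ≤ risk T (hist B (tilt L γ σ)) := by
  by_contra! hlt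
  set R : Fin m → (Fin m → Bool) → ℝ≥0∞ := fun j σ =>
    ∫⁻ X, pairLoss B T (hist B (tilt L γ σ)) j X ∂(sampleLaw n (hist B (tilt L γ σ))) with hR
  have hsum : ∀ σ, ∑ j, R j σ ≤ risk T (hist B (tilt L γ σ)) := by
    intro σ
    have hac := sampleLaw_absolutelyContinuous (n := n)
      (hist_tilt_mem hm hB hv hvol hL h0 h1 hLv σ) (measurable_hist hm _)
    rw [hR, ← lintegral_finsetSum' _ fun j _ =>
      (aemeasurable_pairLoss hT (measurable_hist hm _) j).mono_ac hac]
    exact lintegral_mono fun X => sum_pairLoss_le hm hB T _ X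
  -- `flip j` permutes the cube, so both risks of a flipped couple have the same sum over `σ`.
  have hcube : ∀ j, ∑ _σ : Fin m → Bool, ENNReal.ofReal (L ^ 2 * γ ^ 2 / 4 * v) / 2
      ≤ ∑ σ, (R j σ + R j σ) := by
    intro j
    refine (Finset.sum_le_sum fun σ _ =>
      pair_risk_ge hm hB hv hvol hL h0 h1 hLv hγ hT σ j).trans_eq ?_
    rw [Finset.sum_add_distrib, Finset.sum_add_distrib]
    congr 1
    exact Equiv.sum_comp (flip_involutive j).toPerm (R j)
  have htot : ∑ _j : Fin m, ∑ _σ : Fin m → Bool, ENNReal.ofReal (L ^ 2 * γ ^ 2 / 4 * v) / 2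
      ≤ ∑ σ, (risk T (hist B (tilt L γ σ)) + risk T (hist B (tilt L γ σ))) := by
    refine (Finset.sum_le_sum fun j _ => hcube j).trans ?_
    rw [Finset.sum_comm]
    refine Finset.sum_le_sum fun σ _ => ?_
    rw [Finset.sum_add_distrib]
    exact add_le_add (hsum σ) (hsum σ)
  -- Since `L m v = 1`, the `m` pairs contribute `m L² γ² v / 8 = L γ² / 8`, twice the claimed
  -- bound.
  have hconst : ∑ _j : Fin m, ∑ _σ : Fin m → Bool, ENNReal.ofReal (L ^ 2 * γ ^ 2 / 4 * v) / 2
      = ∑ _σ : Fin m → Bool,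
        (ENNReal.ofReal (L * γ ^ 2 / 16) + ENNReal.ofReal (L * γ ^ 2 / 16)) := by
    rw [Finset.sum_comm]
    refine Finset.sum_congr rfl fun σ _ => ?_
    rw [Finset.sum_const, Finset.card_univ, Fintype.card_fin, nsmul_eq_mul,
      ← ENNReal.ofReal_natCast, ← ENNReal.ofReal_ofNat 2, ← ENNReal.ofReal_div_of_pos two_pos,
      ← ENNReal.ofReal_mul (by positivity), ← ENNReal.ofReal_add (by positivity) (by positivity)]
    congr 1
    linear_combination (L * γ ^ 2 / 8) * hLv
  rw [hconst] at htot
  refine absurd htot (not_le.2 (ENNReal.sum_lt_sum_of_nonempty Finset.univ_nonempty fun σ _ =>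
    ENNReal.add_lt_add (hlt σ) (hlt σ)))

end Assouad

/-! ### The dictionary and the lower bound. -/

/-- Heights of the dictionary: the flat density, then the tilts of the pairs, all scaled by `M`. -/
noncomputable def dictionary (m : ℕ) (L : ℝ) : Fin (m + 1) → Fin m × Bool → ℝ :=
  Fin.cons (fun _ => (m + 1) * (L / 2)) fun j i =>
    if i.1 = j then (m + 1) * (L / 2) * halfSign i.2 else 0

/-- The weights of the tilted densities in the dictionary. -/
noncomputable def tiltWeight {m : ℕ} (γ : ℝ) (σ : Fin m → Bool) : Fin (m + 1) → ℝ :=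
  Fin.cons (1 / (m + 1)) fun j => if σ j then γ / (m + 1) else 0

/-- Scaling the dictionary up by `m + 1` makes every weight at most `1 / (m + 1)`, so the whole cube
fits in the simplex. -/
theorem tiltWeight_mem_simplex {m : ℕ} {γ : ℝ} (h0 : 0 ≤ γ) (h1 : γ ≤ 1) (σ : Fin m → Bool) :
    tiltWeight γ σ ∈ simplex (m + 1) := by
  refine ⟨fun j => ?_, ?_⟩
  · refine Fin.cases ?_ (fun j => ?_) j
    · simp only [tiltWeight, Fin.cons_zero]; positivity
    · simp only [tiltWeight, Fin.cons_succ]; split_ifs <;> positivity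
  · rw [Fin.sum_univ_succ]
    simp only [tiltWeight, Fin.cons_zero, Fin.cons_succ]
    calc 1 / ((m : ℝ) + 1) + ∑ j, (if σ j then γ / (m + 1) else 0)
        ≤ 1 / ((m : ℝ) + 1) + ∑ _j : Fin m, 1 / ((m : ℝ) + 1) := by
          gcongr with j
          split_ifs
          · gcongr
          · positivity
      _ = 1 := by
          simp only [Finset.sum_const, Finset.card_univ, Fintype.card_fin, nsmul_eq_mul]
          field_simp
          ring

theorem sum_tiltWeight_mul_dictionary {m : ℕ} (L γ : ℝ) (σ : Fin m → Bool) (i : Fin m × Bool) :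
    ∑ j, tiltWeight γ σ j * dictionary m L j i = tilt L γ σ i := by
  have hm : (m : ℝ) + 1 ≠ 0 := by positivity
  rw [Fin.sum_univ_succ]
  simp only [tiltWeight, dictionary, Fin.cons_zero, Fin.cons_succ, tilt]
  rw [Finset.sum_eq_single i.1]
  · simp only [if_true]
    split_ifs
    · field_simp
    · field_simp
      ring
  · intro j _ hj
    rw [if_neg (Ne.symm hj), mul_zero]
  · simp

theorem lowerBound_simplex {d : ℕ} (hd : 1 ≤ d) {L : ℝ} (hL : 0 < L) {c₀ : ℝ} (hc₀ : 0 < c₀) :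
    LowerBound (boundedDensities d L) simplex (range c₀) (fun M n => L * (M : ℝ) / (n : ℝ))
      (min (1 / 4) (1 / c₀) / 16) := by
  intro M
  by_cases hM : 2 ≤ M
  swap
  -- For `M < 2` no pair lies in the range, so any dictionary will do.
  · exact ⟨0, fun _ => MemLp.zero, fun n hn => absurd hn.1 hM⟩
  obtain ⟨m, rfl⟩ : ∃ m, M = m + 1 := ⟨M - 1, by omega⟩
  have hm1 : (1 : ℝ) ≤ m := by exact_mod_cast (by omega : 1 ≤ m)
  set v : ℝ := 1 / (L * m) with hvdef
  have hv : 0 < v := by positivity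
  have hLv : L * m * v = 1 := by rw [hvdef]; field_simp
  obtain ⟨B, hm, hB, hvol⟩ := exists_disjoint_cells (ι := Fin m × Bool) hd hv
  -- The dictionary is fixed before `n`: the sample size enters only through `γ`, that is through
  -- the weights.
  refine ⟨fun j => hist B (dictionary m L j), fun j => memLp_hist hm hvol 2 _, ?_⟩
  rintro n ⟨-, hn, hMn⟩ T hT
  dsimp only at hn hMn
  have hn0 : (0 : ℝ) < n := by exact_mod_cast hn
  -- `K ≤ 1 / c₀` and `M ≤ c₀ n` give `γ ≤ 1`. `K ≤ 1 / 4` and `(m + 1) / m ≤ 2` give `n γ² / m ≤ 1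
  -- / 2`, so the second moment of the likelihood ratio of the sample is at most `exp (1 / 2) ≤ 2`.
  set K : ℝ := min (1 / 4) (1 / c₀) with hK
  have hK0 : 0 < K := by positivity
  have hK4 : K ≤ 1 / 4 := min_le_left _ _
  have hKc : K ≤ 1 / c₀ := min_le_right _ _
  set γ : ℝ := √(K * ((m + 1 : ℕ) : ℝ) / n) with hγdef
  have h0 : 0 ≤ γ := Real.sqrt_nonneg _
  have hγ2 : γ ^ 2 = K * ((m + 1 : ℕ) : ℝ) / n := Real.sq_sqrt (by positivity)
  have h1 : γ ≤ 1 := by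
    rw [hγdef, Real.sqrt_le_left zero_le_one, one_pow, div_le_one hn0]
    calc K * ((m + 1 : ℕ) : ℝ) ≤ 1 / c₀ * (c₀ * n) := by gcongr
      _ = n := by field_simp
  have hγ : (1 + L * γ ^ 2 * v) ^ n ≤ 2 := by
    have hx : L * γ ^ 2 * v = γ ^ 2 / m := by rw [hvdef]; field_simp
    have hle : n * (γ ^ 2 / m) ≤ 1 / 2 := by
      rw [hγ2]
      have : n * (K * ((m + 1 : ℕ) : ℝ) / n / m) = K * ((m + 1) / m) := by
        push_cast; field_simp
      rw [this]
      have : ((m : ℝ) + 1) / m ≤ 2 := by rw [div_le_iff₀ (by linarith)]; linarith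
      nlinarith
    calc (1 + L * γ ^ 2 * v) ^ n ≤ Real.exp (γ ^ 2 / m) ^ n := by
          rw [hx]
          gcongr
          linarith [Real.add_one_le_exp (γ ^ 2 / m)]
      _ = Real.exp (n * (γ ^ 2 / m)) := by rw [Real.exp_nat_mul]
      _ ≤ Real.exp (1 / 2) := Real.exp_le_exp.2 hle
      _ ≤ 2 := by
          have h := Real.exp_one_lt_d9
          have h' : Real.exp (1 / 2) ^ 2 = Real.exp 1 := by
            rw [← Real.exp_nat_mul]; norm_num
          nlinarith [Real.exp_pos (1 / 2 : ℝ)]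
  obtain ⟨σ, hσ⟩ := exists_risk_ge hm hB hv.le hvol hL h0 h1 hLv hγ hT
  refine le_trans ?_ (le_iSup₂ (f := fun p (_ : p ∈ boundedDensities d L) =>
    excessRisk (simplex (m + 1)) (fun j => hist B (dictionary m L j)) T p) _
    (hist_tilt_mem hm hB hv.le hvol hL h0 h1 hLv σ))
  -- The true density is itself a convex combination, so excess risk and risk coincide.
  have hinf : ⨅ w ∈ simplex (m + 1), sqDist (mix (fun j => hist B (dictionary m L j)) w)
      (hist B (tilt L γ σ)) = 0 := by
    refine le_antisymm ?_ zero_le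
    refine (iInf₂_le _ (tiltWeight_mem_simplex h0 h1 σ)).trans_eq ?_
    rw [mix_hist _ _ hB]
    simp_rw [sum_tiltWeight_mul_dictionary]
    simp [sqDist]
  rw [excessRisk, hinf, EReal.coe_ennreal_zero, sub_zero]
  have hval : K / 16 * (L * ((m + 1 : ℕ) : ℝ) / n) = L * γ ^ 2 / 16 := by rw [hγ2]; ring
  beta_reduce
  rw [hval, ← max_eq_left (a := L * γ ^ 2 / 16) (b := 0) (by positivity),
    ← EReal.coe_ennreal_ofReal]
  exact EReal.coe_ennreal_le_coe_ennreal_iff.2 hσ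

end DensityAggregation

theorem corollary3p2 :
    ∃ C : ℝ, ∀ c₀ : ℝ, 0 < c₀ → ∃ c : ℝ, 0 < c ∧ ∀ (d : ℕ) (L : ℝ), 1 ≤ d → 0 < L →
      DensityAggregation.IsOptimalRate (DensityAggregation.boundedDensities d L)
        DensityAggregation.simplex (DensityAggregation.range c₀)
        (fun M n => L * (M : ℝ) / (n : ℝ)) C c ∧
      (∃ A : DensityAggregation.Procedure d, DensityAggregation.IsConvexProcedure A) ∧
      ∀ A : DensityAggregation.Procedure d, DensityAggregation.IsConvexProcedure A →
        DensityAggregation.IsRateOptimalAggregate (DensityAggregation.boundedDensities d L)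
          DensityAggregation.simplex (DensityAggregation.range c₀)
          (fun M n => L * (M : ℝ) / (n : ℝ)) C c A := by
  refine ⟨1, fun c₀ hc₀ => ⟨min (1 / 4) (1 / c₀) / 16, by positivity, fun d L hd hL => ?_⟩⟩
  have hlow := DensityAggregation.lowerBound_simplex hd hL hc₀
  refine ⟨⟨fun M n h => ?_, fun M n h f hf => ?_, by positivity, hlow⟩,
    DensityAggregation.exists_isConvexProcedure d,
    fun A hA => ⟨⟨by positivity, hlow⟩, fun M n h f hf => ?_⟩⟩
  · have hM : (0 : ℝ) < M := by exact_mod_cast (by have := h.1; dsimp only at this; omega : 0 < M)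
    have hn : (0 : ℝ) < n := by exact_mod_cast h.2.1
    positivity
  · obtain ⟨T, hT⟩ := DensityAggregation.exists_isConvexAggregate (n := n) hf
    refine ⟨T, DensityAggregation.isEstimator_of_isConvexAggregate hf hT, ?_⟩
    rw [one_mul]
    exact DensityAggregation.maxExcessRisk_convexAggregate_le hL h.2.1 hf hT
  · have hT := hA M n h.1 h.2.1 f hf
    refine ⟨DensityAggregation.isEstimator_of_isConvexAggregate hf hT, ?_⟩
    rw [one_mul]
    exact DensityAggregation.maxExcessRisk_convexAggregate_le hL h.2.1 hf hT
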